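/- Let $\mathbb{S}^1=\mathbb{R}/2\pi\mathbb{Z}$ with coordinate $\beta$, $\Omega=\mathbb{R}\times\mathbb{S}^1$ with coordinates $(t,x)$, and identify $L^2(\Omega)$ with $L^2(\mathbb{R};L^2(\mathbb{S}^1))$. Let $\Delta_\Omega$ be the Laplacian and $\Lambda=(1-\Delta_\Omega)^{-1/2}$. Let $\mathcal{A}^\dagger$ be the C*-subalgebra of $\mathcal{L}(L^2(\Omega))$ generated by the multiplication operators $a(M_x)$, $(a(M_x)f)(t,x)=a(x)f(t,x)$, $a\in C^\infty(\mathbb{S}^1)$, and by $\Lambda$, $\frac1i\frac{\partial}{\partial t}\Lambda$ and $\frac1i\frac{\partial}{\partial\beta}\Lambda$. Let $\mathcal{A}^\diamond$ be the C*-subalgebra generated by $\mathcal{A}^\dagger$ and the multiplications $p(M_t)$, $(p(M_t)f)(t,x)=p(t)f(t,x)$, by continuous $2\pi$-periodic functions $p:\mathbb{R}\to\mathbb{C}$. Let $F$ be the Fourier transform in the real variable, $(Fu)(\tau,\cdot)=\frac1{\sqrt{2\pi}}\int_{\mathbb{R}}e^{-it\tau}u(t,\cdot)\,dt$, and put $\mathcal{B}^\dagger=F^{-1}\mathcal{A}^\dagger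 F$, $\mathcal{B}^\diamond=F^{-1}\mathcal{A}^\diamond F$. **Theorem.** Every $B\in\mathcal{B}^\dagger$ is the operator of multiplication $(Bu)(\tau)=B(\tau)u(\tau)$ by a (unique) bounded norm-continuous function $\tau\mapsto B(\tau)\in\mathcal{L}(L^2(\mathbb{S}^1))$, and translation by one, $[\alpha(B)](\tau)=B(\tau-1)$, defines a $*$-automorphism $\alpha$ of $\mathcal{B}^\dagger$. For this $\alpha$ there is a $*$-isomorphism $$\mathcal{B}^\diamond\;\cong\;\mathcal{B}^\dagger\rtimes_\alpha\mathbb{Z},$$ where $\mathcal{B}^\dagger\rtimes_\alpha\mathbb{Z}$ is the enveloping C*-algebra of the Banach $*$-algebra $\ell^1(\mathbb{Z},\mathcal{B}^\dagger)$ of summable $\mathbb{Z}$-sequences in $\mathcal{B}^\dagger$, with product $(\mathbf{A}*\mathbf{B})(n)=\sum_{k\in\mathbb{Z}}A_k\,\alpha^k(B_{n-k})$ and involution $\mathbf{A}^*(n)=\alpha^n(A_{-n}^*)$, that is, its completion for the seminorm $\mathbf{A}\mapsto\sup_\pi\|\pi(\mathbf{A})\|$, the supremum being taken over all $*$-representations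 $\pi$ on Hilbert spaces. -/

import Mathlib

open scoped ENNReal BoundedContinuousFunction

noncomputable section

universe u

/-- For an automorphism `α` of a unital C⋆-algebra `A`, the Banach space `ℓ¹(ℤ, A)` of summable
`ℤ`-sequences in `A`; it is made below into a Banach `*`-algebra with the twisted convolution
`(a * b)(n) = ∑ₖ a(k) αᵏ(b(n - k))` and the involution `a⋆(n) = αⁿ(a(-n)⋆)`. -/
def CrossedL1 {A : Type u} [CStarAlgebra A] (_α : A ≃⋆ₐ[ℂ] A) : Type u := lp (fun _ : ℤ => A) 1

namespace CrossedL1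
variable {A : Type u} [CStarAlgebra A] {α : A ≃⋆ₐ[ℂ] A}

instance : NormedAddCommGroup (CrossedL1 α) :=
  inferInstanceAs (NormedAddCommGroup (lp (fun _ : ℤ => A) 1))
instance : NormedSpace ℂ (CrossedL1 α) :=
  inferInstanceAs (NormedSpace ℂ (lp (fun _ : ℤ => A) 1))
instance : CompleteSpace (CrossedL1 α) :=
  inferInstanceAs (CompleteSpace (lp (fun _ : ℤ => A) 1))

instance : FunLike (CrossedL1 α) ℤ A where
  coe a := a.1
  coe_injective := Subtype.val_injective

theorem ext {a b : CrossedL1 α} (h : ∀ n, a n = b n) : a = b := DFunLike.ext _ _ h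

theorem add_apply (a b : CrossedL1 α) (n : ℤ) : (a + b) n = a n + b n := rfl
theorem smul_apply (c : ℂ) (a : CrossedL1 α) (n : ℤ) : (c • a) n = c • a n := rfl
theorem zero_apply (n : ℤ) : (0 : CrossedL1 α) n = 0 := rfl

theorem hasSum_norm (a : CrossedL1 α) : HasSum (fun n => ‖a n‖) ‖a‖ := by
  have h := lp.hasSum_norm (p := 1) (by simp) (show lp (fun _ : ℤ => A) 1 from a)
  simp only [ENNReal.toReal_one, Real.rpow_one] at h
  exact h

theorem norm_eq (a : CrossedL1 α) : ‖a‖ = ∑' n, ‖a n‖ := a.hasSum_norm.tsum_eq.symm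

/-- A sequence with summable norms, as an element of the convolution algebra. -/
def mk (f : ℤ → A) (hf : Summable fun n => ‖f n‖) : CrossedL1 α :=
  ⟨f, memℓp_gen (by simpa using hf)⟩

theorem mk_apply (f : ℤ → A) (hf : Summable fun n => ‖f n‖) (n : ℤ) :
    (mk f hf : CrossedL1 α) n = f n := rfl

theorem norm_pow_apply (k : ℤ) (x : A) : ‖(α ^ k) x‖ = ‖x‖ := StarAlgEquiv.norm_map _ _

/-- The shear `(n, k) ↦ (k, n - k)`. -/
def shear : ℤ × ℤ ≃ ℤ × ℤ where
  toFun p := (p.2, p.1 - p.2)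
  invFun p := (p.1 + p.2, p.1)
  left_inv p := by ext <;> simp
  right_inv p := by ext <;> simp

theorem summable_pair (a b : CrossedL1 α) :
    Summable fun p : ℤ × ℤ => ‖a p.2 * (α ^ p.2) (b (p.1 - p.2))‖ := by
  have h : Summable fun p : ℤ × ℤ => ‖a p.1‖ * ‖b p.2‖ :=
    a.hasSum_norm.summable.mul_of_nonneg b.hasSum_norm.summable
      (fun _ => norm_nonneg _) (fun _ => norm_nonneg _)
  refine Summable.of_nonneg_of_le (fun _ => norm_nonneg _) (fun p => ?_) (shear.summable_iff.2 h)
  refine (norm_mul_le _ _).trans ?_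
  rw [norm_pow_apply]; rfl

theorem summable_conv (a b : CrossedL1 α) (n : ℤ) :
    Summable fun k : ℤ => a k * (α ^ k) (b (n - k)) :=
  ((summable_pair a b).prod_factor n).of_norm

theorem summable_norm_conv (a b : CrossedL1 α) :
    Summable fun n : ℤ => ‖∑' k : ℤ, a k * (α ^ k) (b (n - k))‖ :=
  Summable.of_nonneg_of_le (fun _ => norm_nonneg _)
    (fun n => norm_tsum_le_tsum_norm ((summable_pair a b).prod_factor n))
    (summable_pair a b).prod

instance : Mul (CrossedL1 α) where
  mul a b := mk (fun n => ∑' k : ℤ, a k * (α ^ k) (b (n - k))) (summable_norm_conv a b)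

theorem mul_apply (a b : CrossedL1 α) (n : ℤ) :
    (a * b) n = ∑' k : ℤ, a k * (α ^ k) (b (n - k)) := rfl

instance : Star (CrossedL1 α) where
  star a := mk (fun n => (α ^ n) (star (a (-n)))) <| by
    simp only [norm_pow_apply, norm_star]
    exact (Equiv.neg ℤ).summable_iff.2 a.hasSum_norm.summable

theorem star_apply (a : CrossedL1 α) (n : ℤ) : (star a) n = (α ^ n) (star (a (-n))) := rfl

/-- The sequence with entry `x` at `n` and all other entries zero. -/
def single (n : ℤ) (x : A) : CrossedL1 α := lp.single 1 n x

theorem single_apply (n m : ℤ) (x : A) :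
    (single n x : CrossedL1 α) m = if m = n then x else 0 := by
  by_cases h : m = n
  · subst h
    rw [if_pos rfl]
    exact lp.single_apply_self (E := fun _ : ℤ => A) 1 m x
  · rw [if_neg h]
    exact lp.single_apply_ne (E := fun _ : ℤ => A) 1 n x h

instance : One (CrossedL1 α) := ⟨single 0 1⟩

theorem one_apply (n : ℤ) : (1 : CrossedL1 α) n = if n = 0 then 1 else 0 := single_apply 0 n 1

theorem pow_apply_add (k m : ℤ) (x : A) : (α ^ (k + m)) x = (α ^ k) ((α ^ m) x) := by
  rw [zpow_add]; rfl

theorem map_tsum_pow (k : ℤ) {f : ℤ → A} (hf : Summable f) :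
    (α ^ k) (∑' m, f m) = ∑' m, (α ^ k) (f m) :=
  (hf.map_tsum (α ^ k) (StarAlgEquiv.isometry (α ^ k)).continuous)

theorem mul_le (a b : CrossedL1 α) : ‖a * b‖ ≤ ‖a‖ * ‖b‖ := by
  have h : Summable fun p : ℤ × ℤ => ‖a p.1‖ * ‖b p.2‖ :=
    a.hasSum_norm.summable.mul_of_nonneg b.hasSum_norm.summable
      (fun _ => norm_nonneg _) (fun _ => norm_nonneg _)
  calc ‖a * b‖ = ∑' n, ‖∑' k : ℤ, a k * (α ^ k) (b (n - k))‖ := norm_eq _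
    _ ≤ ∑' n, ∑' k : ℤ, ‖a k * (α ^ k) (b (n - k))‖ :=
        (summable_norm_conv a b).tsum_le_tsum
          (fun n => norm_tsum_le_tsum_norm ((summable_pair a b).prod_factor n))
          (summable_pair a b).prod
    _ = ∑' p : ℤ × ℤ, ‖a p.2 * (α ^ p.2) (b (p.1 - p.2))‖ := (summable_pair a b).tsum_prod.symm
    _ ≤ ∑' p : ℤ × ℤ, ‖a (shear p).1‖ * ‖b (shear p).2‖ := by
        refine (summable_pair a b).tsum_le_tsum (fun p => ?_) (shear.summable_iff.2 h)
        refine (norm_mul_le _ _).trans ?_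
        rw [norm_pow_apply]; rfl
    _ = ∑' p : ℤ × ℤ, ‖a p.1‖ * ‖b p.2‖ := shear.tsum_eq (fun p => ‖a p.1‖ * ‖b p.2‖)
    _ = ‖a‖ * ‖b‖ := by
        rw [h.tsum_prod, norm_eq a, norm_eq b, ← tsum_mul_right]
        refine tsum_congr fun k => ?_
        exact tsum_mul_left (a := ‖a k‖) (f := fun m => ‖b m‖)

theorem conv_assoc (a b c : CrossedL1 α) : a * b * c = a * (b * c) := by
  refine ext fun n => ?_
  have hs : Summable fun p : ℤ × ℤ =>
      a p.1 * (α ^ p.1) (b p.2) * (α ^ (p.1 + p.2)) (c (n - (p.1 + p.2))) := by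
    have h : Summable fun p : ℤ × ℤ => ‖a p.1‖ * ‖b p.2‖ * ‖c‖ :=
      (a.hasSum_norm.summable.mul_of_nonneg b.hasSum_norm.summable
        (fun _ => norm_nonneg _) (fun _ => norm_nonneg _)).mul_right _
    refine Summable.of_norm_bounded h fun p => ?_
    have hc : ‖c (n - (p.1 + p.2))‖ ≤ ‖c‖ :=
      le_hasSum c.hasSum_norm _ (fun _ _ => norm_nonneg _)
    refine (norm_mul_le _ _).trans ?_
    rw [norm_pow_apply]
    gcongr
    refine (norm_mul_le _ _).trans ?_
    rw [norm_pow_apply]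
  have h1 : (a * (b * c)) n = ∑' k, ∑' m,
      a k * (α ^ k) (b m) * (α ^ (k + m)) (c (n - (k + m))) := by
    rw [mul_apply]
    refine tsum_congr fun k => ?_
    rw [mul_apply, map_tsum_pow k (summable_conv b c _), ← Summable.tsum_mul_left]
    · refine tsum_congr fun m => ?_
      rw [map_mul, ← pow_apply_add, mul_assoc, sub_sub]
    · exact (summable_conv b c (n - k)).map (α ^ k) (StarAlgEquiv.isometry (α ^ k)).continuous
  have h2 : (a * b * c) n = ∑' l, ∑' k,
      a k * (α ^ k) (b (l - k)) * (α ^ l) (c (n - l)) := by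
    rw [mul_apply]
    refine tsum_congr fun l => ?_
    rw [mul_apply, ← Summable.tsum_mul_right]
    exact summable_conv a b l
  have hs' : Summable fun p : ℤ × ℤ =>
      a p.2 * (α ^ p.2) (b (p.1 - p.2)) * (α ^ p.1) (c (n - p.1)) := by
    have := shear.summable_iff.2 hs
    simpa [Function.comp_def, shear] using this
  rw [h1, h2, ← hs.tsum_prod (f := fun p : ℤ × ℤ =>
      a p.1 * (α ^ p.1) (b p.2) * (α ^ (p.1 + p.2)) (c (n - (p.1 + p.2)))),
    ← hs'.tsum_prod (f := fun p : ℤ × ℤ =>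
      a p.2 * (α ^ p.2) (b (p.1 - p.2)) * (α ^ p.1) (c (n - p.1))),
    ← shear.tsum_eq (fun p : ℤ × ℤ =>
      a p.1 * (α ^ p.1) (b p.2) * (α ^ (p.1 + p.2)) (c (n - (p.1 + p.2))))]
  refine tsum_congr fun p => ?_
  simp [shear]

instance : NormedRing (CrossedL1 α) where
  __ := (inferInstance : NormedAddCommGroup (CrossedL1 α))
  mul_assoc := conv_assoc
  one_mul a := ext fun n => by
    rw [mul_apply, tsum_eq_single 0]
    · simp [one_apply]
    · intro k hk; simp [one_apply, hk]
  mul_one a := ext fun n => by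
    rw [mul_apply, tsum_eq_single n]
    · simp [one_apply]
    · intro k hk
      have : n - k ≠ 0 := sub_ne_zero.2 hk.symm
      simp [one_apply, this]
  left_distrib a b c := ext fun n => by
    rw [add_apply, mul_apply, mul_apply, mul_apply,
      ← (summable_conv a b n).tsum_add (summable_conv a c n)]
    exact tsum_congr fun k => by rw [add_apply, map_add, mul_add]
  right_distrib a b c := ext fun n => by
    rw [add_apply, mul_apply, mul_apply, mul_apply,
      ← (summable_conv a c n).tsum_add (summable_conv b c n)]
    exact tsum_congr fun k => by rw [add_apply, add_mul]
  zero_mul a := ext fun n => by simp [mul_apply, zero_apply]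
  mul_zero a := ext fun n => by simp [mul_apply, zero_apply]
  dist_eq := dist_eq_norm_neg_add
  norm_mul_le := mul_le

instance : NormedAlgebra ℂ (CrossedL1 α) where
  __ := Algebra.ofModule
    (fun c a b => ext fun n => by
      rw [smul_apply, mul_apply, mul_apply, ← (summable_conv a b n).tsum_const_smul]
      exact tsum_congr fun k => by rw [smul_apply, smul_mul_assoc])
    (fun c a b => ext fun n => by
      rw [smul_apply, mul_apply, mul_apply, ← (summable_conv a b n).tsum_const_smul]
      exact tsum_congr fun k => by rw [smul_apply, map_smul, mul_smul_comm])
  norm_smul_le := norm_smul_le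

instance : StarRing (CrossedL1 α) where
  star_involutive a := ext fun n => by
    rw [star_apply, star_apply, ← map_star, ← pow_apply_add]; simp
  star_add a b := ext fun n => by simp [star_apply, add_apply]
  star_mul a b := ext fun n => by
    have e : Summable fun k => star (a k * (α ^ k) (b (-n - k))) := (summable_conv a b (-n)).star
    rw [star_apply, mul_apply, tsum_star, map_tsum_pow n e, mul_apply,
      ← ((Equiv.addLeft n).tsum_eq fun k => (star b) k * (α ^ k) ((star a) (n - k)))]
    refine tsum_congr fun k => ?_
    simp only [star_apply, Equiv.coe_addLeft, star_mul, map_mul, ← map_star, ← pow_apply_add]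
    rw [show -n - k = -(n + k) by ring, show -(n - (n + k)) = k by ring,
      show n + k + (n - (n + k)) = n by ring]

instance : StarModule ℂ (CrossedL1 α) where
  star_smul c a := ext fun n => by simp [star_apply, smul_apply]

instance : NormedStarGroup (CrossedL1 α) where
  norm_star_le a := by
    rw [norm_eq, norm_eq, ← (Equiv.neg ℤ).tsum_eq (fun n => ‖a n‖)]
    simp [star_apply, norm_pow_apply]

instance [Nontrivial A] : NormOneClass (CrossedL1 α) where
  norm_one := by
    rw [norm_eq, tsum_eq_single 0]
    · simp [one_apply]
    · intro n hn; simp [one_apply, hn]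

end CrossedL1

/-- A non-degenerate (that is, unital) `*`-representation of `ℓ¹(ℤ, A)` on a nonzero Hilbert space.
(Degenerate representations only add a zero summand to these, and the zero space contributes
nothing, so that they do not change the enveloping norm.) -/
structure CrossedRep {A : Type u} [CStarAlgebra A] (α : A ≃⋆ₐ[ℂ] A) : Type (u + 1) where
  H : Type u
  [normed : NormedAddCommGroup H]
  [inner : InnerProductSpace ℂ H]
  [complete : CompleteSpace H]
  [nontrivial : Nontrivial H]
  toHom : CrossedL1 α →⋆ₐ[ℂ] (H →L[ℂ] H)

attribute [instance] CrossedRep.normed CrossedRep.inner CrossedRep.complete CrossedRep.nontrivial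

namespace CrossedRep
variable {A : Type u} [CStarAlgebra A] {α : A ≃⋆ₐ[ℂ] A}

theorem nontrivial_base (π : CrossedRep α) : Nontrivial A := by
  by_contra h
  have := not_nontrivial_iff_subsingleton.1 h
  have h0 : (1 : CrossedL1 α) = 0 := CrossedL1.ext fun n => Subsingleton.elim _ _
  have h1 := congrArg π.toHom h0
  rw [map_one, map_zero] at h1
  exact one_ne_zero h1

/-- Every `*`-representation is automatically contractive for the `ℓ¹`-norm. -/
theorem norm_apply_le (π : CrossedRep α) (x : CrossedL1 α) : ‖π.toHom x‖ ≤ ‖x‖ := by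
  have := π.nontrivial_base
  have h1 : ‖π.toHom (star x * x)‖₊ ≤ ‖star x * x‖₊ := by
    have hsa : IsSelfAdjoint (π.toHom (star x * x)) := (IsSelfAdjoint.star_mul_self x).map π.toHom
    rw [← ENNReal.coe_le_coe, ← hsa.spectralRadius_eq_nnnorm]
    refine le_trans (iSup_le_iSup_of_subset (AlgHom.spectrum_apply_subset π.toHom _)) ?_
    exact spectrum.spectralRadius_le_nnnorm (𝕜 := ℂ) (star x * x)
  have h2 : ‖π.toHom x‖ * ‖π.toHom x‖ ≤ ‖x‖ * ‖x‖ := by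
    rw [← CStarRing.norm_star_mul_self, ← map_star, ← map_mul]
    refine (NNReal.coe_le_coe.2 h1).trans ?_
    refine (norm_mul_le (star x) x).trans ?_
    rw [norm_star]
  exact (mul_self_le_mul_self_iff (norm_nonneg _) (norm_nonneg _)).2 h2

end CrossedRep

section CrossedProduct
variable {A : Type u} [CStarAlgebra A] (α : A ≃⋆ₐ[ℂ] A)

/-- The direct sum of all `*`-representations: `x ↦ (π(x))_π`, into the C⋆-algebra of bounded
families of operators; `‖universalRep α x‖ = sup_π ‖π(x)‖`. -/
def universalRep : CrossedL1 α →⋆ₐ[ℂ] lp (fun π : CrossedRep α => π.H →L[ℂ] π.H) ∞ where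
  toFun x := ⟨fun π => π.toHom x, memℓp_infty ⟨‖x‖, by
    rintro _ ⟨π, rfl⟩
    exact π.norm_apply_le x⟩⟩
  map_one' := lp.ext (funext fun π => map_one π.toHom)
  map_mul' x y := lp.ext (funext fun π => map_mul π.toHom x y)
  map_zero' := lp.ext (funext fun π => map_zero π.toHom)
  map_add' x y := lp.ext (funext fun π => map_add π.toHom x y)
  commutes' c := lp.ext (funext fun π => AlgHomClass.commutes π.toHom c)
  map_star' x := lp.ext (funext fun π => map_star π.toHom x)

/-- The crossed product `A ⋊_α ℤ`, that is, the enveloping C⋆-algebra of `ℓ¹(ℤ, A)`: the (separated)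
completion of `ℓ¹(ℤ, A)` for the seminorm `x ↦ sup_π ‖π(x)‖`, realised as the norm closure of
the image of the universal representation. -/
def CrossedProduct : Type (u + 1) := (universalRep α).range.topologicalClosure

instance : CStarAlgebra (lp (fun π : CrossedRep α => π.H →L[ℂ] π.H) ∞) where

instance : CStarAlgebra (CrossedProduct α) :=
  haveI : IsClosed ((universalRep α).range.topologicalClosure :
      Set (lp (fun π : CrossedRep α => π.H →L[ℂ] π.H) ∞)) :=
    StarSubalgebra.isClosed_topologicalClosure _
  StarSubalgebra.cstarAlgebra (universalRep α).range.topologicalClosure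

end CrossedProduct

section MultOp
variable {X E : Type*} [TopologicalSpace X] [SecondCountableTopology X] [MeasurableSpace X]
  [OpensMeasurableSpace X] [NormedAddCommGroup E] [NormedSpace ℂ E]

open MeasureTheory

theorem memLp_top_bcf {G : Type*} [NormedAddCommGroup G] (μ : Measure X) (f : X →ᵇ G) :
    MemLp f ∞ μ :=
  memLp_top_of_bound f.continuous.aestronglyMeasurable ‖f‖ (ae_of_all _ f.norm_coe_le_norm)

/-- For a bounded norm-continuous operator-valued function `f`, the multiplication operator
`(f(M) u)(x) = f(x) u(x)` on `L²(X, μ; E)`. -/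
def multOp (μ : Measure X) (f : X →ᵇ (E →L[ℂ] E)) : Lp E 2 μ →L[ℂ] Lp E 2 μ :=
  (ContinuousLinearMap.id ℂ (E →L[ℂ] E)).holderL μ ∞ 2 2 ((memLp_top_bcf μ f).toLp f)

theorem multOp_ae (μ : Measure X) (f : X →ᵇ (E →L[ℂ] E)) (u : Lp E 2 μ) :
    multOp μ f u =ᵐ[μ] fun x => f x (u x) := by
  filter_upwards [(ContinuousLinearMap.id ℂ (E →L[ℂ] E)).coeFn_holder (r := 2)
    ((memLp_top_bcf μ f).toLp f) u, (memLp_top_bcf μ f).coeFn_toLp] with x h1 h2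
  exact h1.trans (by rw [h2]; rfl)

/-- The scalar function `p`, viewed as operator-valued function `x ↦ p(x) · I`. -/
def scalarFun (E : Type*) [NormedAddCommGroup E] [NormedSpace ℂ E] (p : X →ᵇ ℂ) :
    X →ᵇ (E →L[ℂ] E) :=
  p • BoundedContinuousFunction.const X (ContinuousLinearMap.id ℂ E)
end MultOp

open MeasureTheory
section Dilation
variable {E : Type*} [NormedAddCommGroup E] [NormedSpace ℂ E]

theorem eLpNorm_dilation (c : ℝ) (hc : 0 < c) (u : ℝ → E) (hu : AEStronglyMeasurable u volume) :
    eLpNorm (fun t => ((Real.sqrt c : ℝ) : ℂ) • u (c * t)) 2 volume = eLpNorm u 2 volume := by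
  have hm : Measure.map (fun t => c * t) volume = ENNReal.ofReal c⁻¹ • (volume : Measure ℝ) := by
    rw [Real.map_volume_mul_left hc.ne', abs_of_pos (inv_pos.2 hc)]
  have hu' : AEStronglyMeasurable u (Measure.map (fun t => c * t) volume) := by
    rw [hm]; exact hu.smul_measure _
  have h1 : eLpNorm (fun t => u (c * t)) 2 volume
      = ENNReal.ofReal c⁻¹ ^ (1 / (2 : ℝ≥0∞)).toReal • eLpNorm u 2 volume := by
    rw [← eLpNorm_smul_measure_of_ne_top (by simp), ← hm,
      eLpNorm_map_measure hu' (by fun_prop)]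
    rfl
  change eLpNorm (((Real.sqrt c : ℝ) : ℂ) • fun t => u (c * t)) 2 volume = _
  rw [eLpNorm_const_smul, h1, smul_eq_mul, ← mul_assoc]
  have h2 : ‖((Real.sqrt c : ℝ) : ℂ)‖ₑ * ENNReal.ofReal c⁻¹ ^ (1 / (2 : ℝ≥0∞)).toReal = 1 := by
    rw [← ofReal_norm, Complex.norm_real, Real.norm_of_nonneg (Real.sqrt_nonneg c),
      ENNReal.ofReal_rpow_of_pos (inv_pos.2 hc), ← ENNReal.ofReal_mul (Real.sqrt_nonneg c)]
    have : (1 / (2 : ℝ≥0∞)).toReal = 1 / 2 := by simp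
    rw [this, ← Real.sqrt_eq_rpow, ← Real.sqrt_mul hc.le, mul_inv_cancel₀ hc.ne']
    simp
  rw [h2, one_mul]

theorem aesm_dilation {E : Type*} [NormedAddCommGroup E] (c : ℝ) (hc : 0 < c) (u : ℝ → E) (hu : AEStronglyMeasurable u volume) :
    AEStronglyMeasurable (fun t => u (c * t)) volume := by
  refine AEStronglyMeasurable.comp_aemeasurable (f := fun t => c * t) ?_ (by fun_prop)
  rw [Real.map_volume_mul_left hc.ne']
  exact hu.smul_measure _

theorem memLp_dilation (c : ℝ) (hc : 0 < c) (u : Lp E 2 (volume : Measure ℝ)) :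
    MemLp (fun t => ((Real.sqrt c : ℝ) : ℂ) • u (c * t)) 2 volume :=
  ⟨(aesm_dilation c hc u (Lp.aestronglyMeasurable u)).const_smul _, by
    rw [eLpNorm_dilation c hc u (Lp.aestronglyMeasurable u)]
    exact Lp.eLpNorm_lt_top u⟩

theorem ae_dilation (c : ℝ) (hc : 0 < c) {P : ℝ → Prop} (h : ∀ᵐ t, P t) :
    ∀ᵐ t : ℝ, P (c * t) := by
  have hq : Measure.QuasiMeasurePreserving (fun t : ℝ => c * t) volume volume :=
    ⟨by fun_prop, by
      rw [Real.map_volume_mul_left hc.ne']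
      exact Measure.smul_absolutelyContinuous⟩
  exact hq.ae h

/-- The dilation `u ↦ √c u(c ·)` of `L²(ℝ; E)`, for `c > 0`, as a linear isometry. -/
def dilationIsometry (c : ℝ) (hc : 0 < c) :
    Lp E 2 (volume : Measure ℝ) →ₗᵢ[ℂ] Lp E 2 (volume : Measure ℝ) where
  toFun u := (memLp_dilation c hc u).toLp
  map_add' u v := by
    rw [← MemLp.toLp_add]
    refine MemLp.toLp_congr _ _ ?_
    filter_upwards [ae_dilation c hc (Lp.coeFn_add u v)] with t ht
    simp only [Pi.add_apply] at ht ⊢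
    rw [ht, smul_add]
  map_smul' a u := by
    rw [RingHom.id_apply, ← MemLp.toLp_const_smul]
    refine MemLp.toLp_congr _ _ ?_
    filter_upwards [ae_dilation c hc (Lp.coeFn_smul a u)] with t ht
    simp only [Pi.smul_apply] at ht ⊢
    rw [ht, smul_comm a]
  norm_map' u := by
    change ‖(memLp_dilation c hc u).toLp‖ = _
    rw [Lp.norm_toLp, eLpNorm_dilation c hc u (Lp.aestronglyMeasurable u), Lp.norm_def]

theorem dilationIsometry_ae (c : ℝ) (hc : 0 < c) (u : Lp E 2 (volume : Measure ℝ)) :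
    dilationIsometry c hc u =ᵐ[volume] fun t => ((Real.sqrt c : ℝ) : ℂ) • u (c * t) :=
  (memLp_dilation c hc u).coeFn_toLp

theorem dilation_left_inv (c d : ℝ) (hc : 0 < c) (hd : 0 < d) (h : c * d = 1)
    (u : Lp E 2 (volume : Measure ℝ)) :
    dilationIsometry c hc (dilationIsometry d hd u) = u := by
  refine Lp.ext ?_
  filter_upwards [dilationIsometry_ae c hc (dilationIsometry d hd u),
    ae_dilation c hc (dilationIsometry_ae d hd u)] with t h1 h2
  rw [h1, h2, smul_smul, ← Complex.ofReal_mul, ← Real.sqrt_mul hc.le, h, ← mul_assoc,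
    mul_comm d c, h]
  simp

/-- The unitary dilation `u ↦ √c u(c ·)` of `L²(ℝ; E)`, for `c > 0`. -/
def dilation (c : ℝ) (hc : 0 < c) :
    Lp E 2 (volume : Measure ℝ) ≃ₗᵢ[ℂ] Lp E 2 (volume : Measure ℝ) where
  toLinearEquiv := LinearEquiv.ofLinearMap (dilationIsometry c hc).toLinearMap
    (dilationIsometry c⁻¹ (inv_pos.2 hc)).toLinearMap
    (LinearMap.ext fun u => dilation_left_inv c c⁻¹ hc (inv_pos.2 hc) (mul_inv_cancel₀ hc.ne') u)
    (LinearMap.ext fun u => dilation_left_inv c⁻¹ c (inv_pos.2 hc) hc (inv_mul_cancel₀ hc.ne') u)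
  norm_map' u := (dilationIsometry c hc).norm_map u

theorem dilation_ae (c : ℝ) (hc : 0 < c) (u : Lp E 2 (volume : Measure ℝ)) :
    dilation c hc u =ᵐ[volume] fun t => ((Real.sqrt c : ℝ) : ℂ) • u (c * t) :=
  dilationIsometry_ae c hc u
end Dilation

section Setting

instance fact_two_pi_pos : Fact (0 < 2 * Real.pi) := ⟨Real.two_pi_pos⟩

/-- The circle `𝕊¹ = ℝ/2πℤ`, with the angle `β` as coordinate. -/
abbrev S1 : Type := AddCircle (2 * Real.pi)

/-- `L²(𝕊¹)` (for the rotation invariant probability measure `dβ/2π`). -/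
abbrev L2S : Type := Lp ℂ 2 (AddCircle.haarAddCircle (T := 2 * Real.pi))

/-- `L²(Ω) = L²(ℝ × 𝕊¹)`, identified with `L²(ℝ; L²(𝕊¹))`. -/
abbrev L2Ω : Type := Lp L2S 2 (volume : Measure ℝ)

section Fourier
variable (E : Type*) [NormedAddCommGroup E] [InnerProductSpace ℂ E] [CompleteSpace E]

/-- The unitary Fourier transform `(F u)(τ) = (2π)^{-1/2} ∫ e^{-itτ} u(t) dt` of `L²(ℝ; E)`. -/
def unitaryFourier : Lp E 2 (volume : Measure ℝ) ≃ₗᵢ[ℂ] Lp E 2 (volume : Measure ℝ) :=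
  (Lp.fourierTransformₗᵢ ℝ E).trans (dilation (2 * Real.pi)⁻¹ (inv_pos.2 Real.two_pi_pos))

theorem unitaryFourier_schwartz (f : SchwartzMap ℝ E) :
    unitaryFourier E (f.toLp 2) =ᵐ[volume] fun τ : ℝ =>
      (((Real.sqrt (2 * Real.pi))⁻¹ : ℝ) : ℂ) •
        ∫ t : ℝ, Complex.exp (-(Complex.I * t * τ)) • f t := by
  have h1 : unitaryFourier E (f.toLp 2) = dilation (2 * Real.pi)⁻¹ (inv_pos.2 Real.two_pi_pos)
      ((FourierTransform.fourier f : SchwartzMap ℝ E).toLp 2) := by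
    rw [← SchwartzMap.toLp_fourier_eq]; rfl
  rw [h1]
  have h0 : ∀ᵐ τ : ℝ, (FourierTransform.fourier f : SchwartzMap ℝ E).toLp 2 volume τ
      = (FourierTransform.fourier f : SchwartzMap ℝ E) τ := SchwartzMap.coeFn_toLp _ _ _
  filter_upwards [dilation_ae (2 * Real.pi)⁻¹ (inv_pos.2 Real.two_pi_pos)
      ((FourierTransform.fourier f : SchwartzMap ℝ E).toLp 2),
    ae_dilation (2 * Real.pi)⁻¹ (inv_pos.2 Real.two_pi_pos) h0] with τ h2 h3
  rw [h2, h3, SchwartzMap.fourier_coe, Real.fourier_eq', Real.sqrt_inv]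
  congr 1
  refine integral_congr_ae (Filter.Eventually.of_forall fun t => ?_)
  simp only [RCLike.inner_apply, conj_trivial]
  congr 2
  push_cast
  have : (Real.pi : ℂ) ≠ 0 := by exact_mod_cast Real.pi_ne_zero
  field_simp

end Fourier

/-- The Fourier transform `F ⊗ I` in the real variable on `L²(ℝ × 𝕊¹)`. -/
def fourierF : L2Ω ≃ₗᵢ[ℂ] L2Ω := unitaryFourier L2S

/-- For a bounded sequence `m`, the Fourier multiplier `F_d⁻¹ m F_d` on `L²(𝕊¹)`, i.e. the
operator that is diagonal in the basis `e^{ijβ}` with eigenvalues `m(j)`. -/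
def circleMultiplier : lp (fun _ : ℤ => ℂ) ∞ →L[ℂ] (L2S →L[ℂ] L2S) :=
  letI D : lp (fun _ : ℤ => ℂ) ∞ →L[ℂ] lp (fun _ : ℤ => ℂ) 2 →L[ℂ] lp (fun _ : ℤ => ℂ) 2 :=
    lp.holderL 2 (fun _ => ContinuousLinearMap.mul ℂ ℂ) (K := 1) (fun _ => by simp)
  letI e := (fourierBasis (T := 2 * Real.pi)).repr
  (ContinuousLinearMap.compL ℂ L2S (lp (fun _ : ℤ => ℂ) 2) L2S
    (e.symm.toContinuousLinearEquiv : lp (fun _ : ℤ => ℂ) 2 →L[ℂ] L2S)) ∘L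
  ((ContinuousLinearMap.compL ℂ L2S (lp (fun _ : ℤ => ℂ) 2) (lp (fun _ : ℤ => ℂ) 2)).flip
    (e.toContinuousLinearEquiv : L2S →L[ℂ] lp (fun _ : ℤ => ℂ) 2)) ∘L D

theorem circleMultiplier_fourierCoeff (m : lp (fun _ : ℤ => ℂ) ∞) (u : L2S) (j : ℤ) :
    fourierCoeff (circleMultiplier m u) j = m j * fourierCoeff u j := by
  rw [← fourierBasis_repr, ← fourierBasis_repr]
  simp [circleMultiplier, lp.holderL]


/-- `(1 + τ² + j²)^{1/2}`, the symbol of `(1 - Δ)^{1/2}` on `ℝ × 𝕊¹`. -/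
def bracket (τ : ℝ) (j : ℤ) : ℝ := Real.sqrt (1 + τ ^ 2 + (j : ℝ) ^ 2)

theorem one_le_bracket (τ : ℝ) (j : ℤ) : 1 ≤ bracket τ j := by
  rw [bracket, Real.one_le_sqrt]; nlinarith [sq_nonneg τ, sq_nonneg (j : ℝ)]

theorem bracket_sq (τ : ℝ) (j : ℤ) : bracket τ j ^ 2 = 1 + τ ^ 2 + (j : ℝ) ^ 2 :=
  Real.sq_sqrt (by positivity)

theorem abs_le_bracket (τ : ℝ) (j : ℤ) : |τ| ≤ bracket τ j :=
  Real.abs_le_sqrt (by nlinarith [sq_nonneg (j : ℝ)])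

theorem abs_int_le_bracket (τ : ℝ) (j : ℤ) : |(j : ℝ)| ≤ bracket τ j :=
  Real.abs_le_sqrt (by nlinarith [sq_nonneg τ])

theorem bracket_sub_le (τ σ : ℝ) (j : ℤ) : |bracket τ j - bracket σ j| ≤ |τ - σ| := by
  have h1 := one_le_bracket τ j
  have h2 := one_le_bracket σ j
  have h3 := abs_le_bracket τ j
  have h4 := abs_le_bracket σ j
  have hpos : 0 < bracket τ j + bracket σ j := by linarith
  have e : |bracket τ j - bracket σ j| * (bracket τ j + bracket σ j) = |τ - σ| * |τ + σ| := by
    have e' : (bracket τ j - bracket σ j) * (bracket τ j + bracket σ j) = (τ - σ) * (τ + σ) := by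
      linear_combination bracket_sq τ j - bracket_sq σ j
    rw [← abs_mul, ← e', abs_mul, abs_of_pos hpos]
  have h5 : |τ + σ| ≤ bracket τ j + bracket σ j := (abs_add_le τ σ).trans (by linarith)
  refine le_of_mul_le_mul_right ?_ hpos
  rw [e]
  exact mul_le_mul_of_nonneg_left h5 (abs_nonneg _)

theorem inv_bracket_sub (τ σ : ℝ) (j : ℤ) (c : ℝ) (hc : |c| ≤ bracket τ j) :
    |c * ((bracket τ j)⁻¹ - (bracket σ j)⁻¹)| ≤ |τ - σ| := by
  have h1 := one_le_bracket τ j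
  have h2 := one_le_bracket σ j
  have e : c * ((bracket τ j)⁻¹ - (bracket σ j)⁻¹) =
      (c * (bracket τ j)⁻¹) * (bracket σ j)⁻¹ * (bracket σ j - bracket τ j) := by
    have : bracket τ j ≠ 0 := by linarith
    have : bracket σ j ≠ 0 := by linarith
    field_simp
  have h3 : |c * (bracket τ j)⁻¹| ≤ 1 := by
    rw [abs_mul, abs_inv, abs_of_pos (by linarith : 0 < bracket τ j), ← div_eq_mul_inv]
    exact div_le_one_of_le₀ hc (by linarith)
  have h4 : |(bracket σ j)⁻¹| ≤ 1 := by
    rw [abs_inv, abs_of_pos (by linarith : 0 < bracket σ j)]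
    exact inv_le_one_of_one_le₀ h2
  rw [e, abs_mul, abs_mul, abs_sub_comm τ σ]
  calc _ ≤ 1 * 1 * |σ - τ| := by
        exact mul_le_mul (mul_le_mul h3 h4 (abs_nonneg _) zero_le_one) (bracket_sub_le σ τ j)
          (abs_nonneg _) (by norm_num)
    _ = _ := by ring

/-- A real function `m(τ, j)`, bounded by `1` and Lipschitz in `τ` uniformly in `j`, as a bounded
continuous map from `ℝ` to `ℓ^∞(ℤ)`. -/
def symbolFun (m : ℝ → ℤ → ℝ) (h1 : ∀ τ j, |m τ j| ≤ 1)
    (h2 : ∀ τ σ j, |m τ j - m σ j| ≤ 2 * |τ - σ|) : ℝ →ᵇ lp (fun _ : ℤ => ℂ) ∞ :=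
  BoundedContinuousFunction.ofNormedAddCommGroup
    (fun τ => ⟨fun j => ((m τ j : ℝ) : ℂ), memℓp_infty ⟨1, by
      rintro _ ⟨j, rfl⟩
      simpa using h1 τ j⟩⟩)
    (by
      refine (LipschitzWith.of_dist_le_mul (K := 2) fun τ σ => ?_).continuous
      rw [dist_eq_norm]
      refine lp.norm_le_of_forall_le (by positivity) fun j => ?_
      rw [lp.coeFn_sub, Pi.sub_apply, ← Complex.ofReal_sub, Complex.norm_real]
      exact h2 τ σ j)
    1
    (fun τ => lp.norm_le_of_forall_le zero_le_one fun j => by simpa using h1 τ j)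

theorem symbolFun_apply (m : ℝ → ℤ → ℝ) (h1 h2) (τ : ℝ) (j : ℤ) :
    symbolFun m h1 h2 τ j = ((m τ j : ℝ) : ℂ) := rfl

/-- The function `τ ↦ (1 + τ² - Δ_𝕊¹)^{-1/2}` (with `-Δ_𝕊¹ e^{ijβ} = j² e^{ijβ}`). -/
def BΛ : ℝ →ᵇ (L2S →L[ℂ] L2S) :=
  circleMultiplier.compLeftContinuousBounded ℝ <|
    symbolFun (fun τ j => (bracket τ j)⁻¹)
      (fun τ j => by
        rw [abs_inv, abs_of_pos (by linarith [one_le_bracket τ j])]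
        exact inv_le_one_of_one_le₀ (one_le_bracket τ j))
      (fun τ σ j => by
        have h := inv_bracket_sub τ σ j 1 (by simpa using one_le_bracket τ j)
        rw [one_mul] at h
        linarith [abs_nonneg (τ - σ)])

theorem abs_div_bracket_le (τ : ℝ) (j : ℤ) (c : ℝ) (hc : |c| ≤ bracket τ j) :
    |c * (bracket τ j)⁻¹| ≤ 1 := by
  have h := one_le_bracket τ j
  rw [abs_mul, abs_inv, abs_of_pos (by linarith : 0 < bracket τ j), ← div_eq_mul_inv]
  exact div_le_one_of_le₀ hc (by linarith)

/-- The function `τ ↦ τ (1 + τ² - Δ_𝕊¹)^{-1/2}`. -/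
def Bt : ℝ →ᵇ (L2S →L[ℂ] L2S) :=
  circleMultiplier.compLeftContinuousBounded ℝ <|
    symbolFun (fun τ j => τ * (bracket τ j)⁻¹)
      (fun τ j => abs_div_bracket_le τ j τ (abs_le_bracket τ j))
      (fun τ σ j => by
        have h1 := inv_bracket_sub τ σ j τ (abs_le_bracket τ j)
        have h2 : |(bracket σ j)⁻¹| ≤ 1 := by
          simpa using abs_div_bracket_le σ j 1 (by simpa using one_le_bracket σ j)
        have h3 : |(τ - σ) * (bracket σ j)⁻¹| ≤ |τ - σ| := by
          rw [abs_mul]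
          exact mul_le_of_le_one_right (abs_nonneg _) h2
        have e : τ * (bracket τ j)⁻¹ - σ * (bracket σ j)⁻¹ =
          τ * ((bracket τ j)⁻¹ - (bracket σ j)⁻¹) + (τ - σ) * (bracket σ j)⁻¹ := by ring
        rw [e]
        exact (abs_add_le _ _).trans (by linarith))

/-- The function `τ ↦ (1/i) ∂_β (1 + τ² - Δ_𝕊¹)^{-1/2}`. -/
def Bβ : ℝ →ᵇ (L2S →L[ℂ] L2S) :=
  circleMultiplier.compLeftContinuousBounded ℝ <|
    symbolFun (fun τ j => (j : ℝ) * (bracket τ j)⁻¹)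
      (fun τ j => abs_div_bracket_le τ j j (abs_int_le_bracket τ j))
      (fun τ σ j => by
        rw [← mul_sub]
        linarith [inv_bracket_sub τ σ j j (abs_int_le_bracket τ j), abs_nonneg (τ - σ)])

/-- The bounded operators on `L²(Ω)`. -/
abbrev BoundedOps : Type := L2Ω →L[ℂ] L2Ω

/-- The Fourier multiplier `F⁻¹ f(M_τ) F` on `L²(Ω)` with the operator-valued symbol `f`. Here
`F⁻¹ τ F = (1/i) ∂/∂t`, so that `F⁻¹ (1 + τ² - Δ_𝕊¹) F = 1 - Δ_Ω`. -/
def fourierMultOp (f : ℝ →ᵇ (L2S →L[ℂ] L2S)) : BoundedOps :=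
  (fourierF.symm.toContinuousLinearEquiv : L2Ω →L[ℂ] L2Ω) ∘L multOp volume f ∘L
    (fourierF.toContinuousLinearEquiv : L2Ω →L[ℂ] L2Ω)

/-- `Λ = (1 - Δ_Ω)^{-1/2}`. -/
def opΛ : BoundedOps := fourierMultOp BΛ

/-- `(1/i) ∂/∂t Λ`. -/
def opDt : BoundedOps := fourierMultOp Bt

/-- `(1/i) ∂/∂β Λ`. -/
def opDβ : BoundedOps := fourierMultOp Bβ

/-- The multiplication operator `(a(M_x) f)(t, x) = a(x) f(t, x)`. -/
def opA (a : C(S1, ℂ)) : BoundedOps :=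
  multOp volume (BoundedContinuousFunction.const ℝ
    (multOp AddCircle.haarAddCircle (scalarFun ℂ (BoundedContinuousFunction.mkOfCompact a))))

/-- The multiplication operator `(p(M_t) f)(t, x) = p(t) f(t, x)`. -/
def opP (p : ℝ →ᵇ ℂ) : BoundedOps := multOp volume (scalarFun L2S p)

/-- The C⋆-algebra `𝒜†` generated by the `a(M_x)`, with `a` a smooth function on `𝕊¹`, and by
`Λ`, `(1/i) ∂/∂t Λ`, `(1/i) ∂/∂β Λ`. -/
def algDagger : StarSubalgebra ℂ BoundedOps :=
  (StarAlgebra.adjoin ℂ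
    ({T | ∃ a : C(S1, ℂ),
        ContDiff ℝ ((⊤ : ℕ∞) : WithTop ℕ∞) (fun β : ℝ => a (β : S1)) ∧ T = opA a} ∪
      {opΛ, opDt, opDβ})).topologicalClosure

/-- The C⋆-algebra `𝒜◇` generated by `𝒜†` and the multiplications `p(M_t)` by continuous
`2π`-periodic functions `p` of `t`. -/
def algDiamond : StarSubalgebra ℂ BoundedOps :=
  (StarAlgebra.adjoin ℂ
    ((algDagger : Set BoundedOps) ∪
      {T | ∃ p : ℝ →ᵇ ℂ, Function.Periodic p (2 * Real.pi) ∧ T = opP p})).topologicalClosure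

/-- The conjugation `T ↦ F⁻¹ T F`. -/
def fourierConj : BoundedOps ≃⋆ₐ[ℂ] BoundedOps :=
  fourierF.symm.conjStarAlgEquiv

theorem fourierConj_apply (T : BoundedOps) (u : L2Ω) :
    fourierConj T u = fourierF.symm (T (fourierF u)) := by
  rfl

/-- `ℬ† = F⁻¹ 𝒜† F`. -/
def algBDagger : StarSubalgebra ℂ BoundedOps :=
  algDagger.map (fourierConj : BoundedOps →⋆ₐ[ℂ] BoundedOps)

/-- `ℬ◇ = F⁻¹ 𝒜◇ F`. -/
def algBDiamond : StarSubalgebra ℂ BoundedOps :=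
  algDiamond.map (fourierConj : BoundedOps →⋆ₐ[ℂ] BoundedOps)

instance isClosed_algBDagger : IsClosed (algBDagger : Set BoundedOps) := by
  have h : IsClosed (algDagger : Set BoundedOps) := StarSubalgebra.isClosed_topologicalClosure _
  exact ((StarAlgEquiv.isometry fourierConj).isClosedEmbedding.isClosedMap) _ h

/-- The translate `τ ↦ f(τ - 1)`. -/
def translateOne (f : ℝ →ᵇ (L2S →L[ℂ] L2S)) : ℝ →ᵇ (L2S →L[ℂ] L2S) :=
  f.compContinuous ⟨fun τ => τ - 1, by fun_prop⟩

end Setting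

end

/-!
# `ℬ◇` is a crossed product of `ℬ†` by `ℤ`

The inclusion of `ℬ†` into the operators on `L²(Ω)` and the translation `U` by one in the variable
`τ` form a covariant pair for the automorphism `α` of `ℬ†`. Its integrated form `∑ Bₙ uⁿ ↦ ∑ Bₙ Uⁿ`
(`CrossedL1.integrated`, `shiftRep`) maps `ℓ¹(ℤ, ℬ†)` onto a dense subalgebra of `ℬ◇`
(`closure_range_shiftRep`): the conjugate `F⁻¹ e^{-int} F` of a multiplication by a character is
`Uⁿ`, and trigonometric polynomials are dense among the continuous periodic functions. What remains
is that this representation is faithful on the crossed product.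

Faithfulness is the gauge-invariant uniqueness theorem (`eq_zero_of_evalRep_eq_zero`). The circle
acts on the crossed product by `B uⁿ ↦ zⁿ B uⁿ`. Suppose that a representation is faithful on the
coefficient algebra, and that it intertwines this dual action with bounded maps on its operators.
If it annihilates `T`, it annihilates the average of `T⋆ T` over the dual action. This average lies
in the coefficient algebra, so it vanishes; as the average of the positive elements `z · (T⋆ T)`,
it can only vanish if `T = 0`. The crossed product is realized inside the bounded families of
operators indexed by all representations `π` of `ℓ¹(ℤ, A)`; there the dual action merely moves the
entry at `π ∘ (z ·)` to `π`.

In the representation on `L²(Ω)`, the dual action of `e^{iθ}` is implemented by the conjugation with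
the multiplication by `e^{iθτ}` (`gaugeConj_shiftRep`). It multiplies `Uⁿ` by `e^{iθn}`, and it
fixes `ℬ†`, because every element of `ℬ†` is the multiplication by a bounded norm-continuous
operator-valued function (`exists_multOp_of_mem`): this holds for the generators, and such
multiplications form a closed algebra, since `f ↦ f(M)` is an injective `*`-homomorphism of
C⋆-algebras and so isometric.

Finally, `ℬ†` has to be invariant under translation by `±1` (`translationConj_mem`). The translate
of the symbol `l = (1 + τ² + j²)^{-1/2}` of `Λ` by `s` is `l h^{-1/2}`, where
`h = (1 + (τ - s)² + j²)/(1 + τ² + j²) = 1 - 2s l t + s² l²` with `t = τ l` the symbol of `-i∂ₜΛ`.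
So `h` belongs to the algebra of symbols, and so does `h^{-1/2}` by the Weierstrass theorem, since
`h` takes values in a compact interval of positive numbers. The translates of the symbols of `-i∂ₜΛ`
and `-i∂_βΛ` are treated in the same way (`translate_mem_of_mem`).
-/

open MeasureTheory

universe u

/-! ### Averaging over a representation of the circle -/

section Average
variable {E ι : Type*} [NormedAddCommGroup E] [NormedSpace ℂ E] {D : Circle → E →L[ℂ] E}
  {e : ℤ → ι → E}

/-- Orbits in the closed span of the eigenvectors `e n i`, of weight `n`, are continuous: the maps
`D z` are contractions, so the orbit of a limit of vectors is a uniform limit of orbits. -/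
theorem continuous_orbit_of_mem_closure (hD : ∀ z T, ‖D z T‖ ≤ ‖T‖)
    (he : ∀ z n i, D z (e n i) = ((z ^ n : Circle) : ℂ) • e n i) {T : E}
    (hT : T ∈ (Submodule.span ℂ (Set.range (Function.uncurry e))).topologicalClosure) :
    Continuous fun z => D z T := by
  have hspan : ∀ T ∈ Submodule.span ℂ (Set.range (Function.uncurry e)),
      Continuous fun z => D z T := by
    intro T hT
    induction hT using Submodule.span_induction with
    | mem _ h =>
      obtain ⟨⟨n, i⟩, rfl⟩ := h
      simp only [Function.uncurry, he]
      have : Continuous fun z : Circle => ((z ^ n : Circle) : ℂ) :=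
        Continuous.comp (g := ((↑) : Circle → ℂ)) continuous_induced_dom (continuous_zpow n)
      exact this.smul continuous_const
    | zero => simpa using continuous_const
    | add _ _ _ _ h1 h2 => simp only [map_add]; exact h1.add h2
    | smul c _ _ h => simp only [map_smul]; exact h.const_smul c
  refine continuous_of_uniform_approx_of_continuous fun U hU => ?_
  obtain ⟨ε, hε, hU⟩ := Metric.mem_uniformity_dist.1 hU
  obtain ⟨S, hS, hST⟩ := Metric.mem_closure_iff.1 hT ε hε
  refine ⟨fun z => D z S, hspan S hS, fun z => hU ?_⟩
  rw [dist_eq_norm, ← map_sub]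
  exact (hD z _).trans_lt (by rwa [← dist_eq_norm])

/-- The maps `D z` are not assumed to form an action; that `D 1` is the identity on the closed span
of the eigenvectors follows from their eigenvalues. -/
theorem orbit_one_of_mem_closure
    (he : ∀ z n i, D z (e n i) = ((z ^ n : Circle) : ℂ) • e n i) {T : E}
    (hT : T ∈ (Submodule.span ℂ (Set.range (Function.uncurry e))).topologicalClosure) :
    D 1 T = T := by
  have h : Set.EqOn (D 1) (ContinuousLinearMap.id ℂ E)
      (Submodule.span ℂ (Set.range (Function.uncurry e))).topologicalClosure := by
    refine Set.EqOn.closure (fun T hT => ?_) (D 1).continuous continuous_id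
    induction hT using Submodule.span_induction with
    | mem _ h =>
      obtain ⟨⟨n, i⟩, rfl⟩ := h
      simp [Function.uncurry, he]
    | zero => simp
    | add _ _ _ _ h1 h2 => simpa using congrArg₂ (· + ·) h1 h2
    | smul c _ _ h => simpa using congrArg (c • ·) h
  exact h hT

theorem integral_circle_exp_zpow {n : ℤ} (hn : n ≠ 0) :
    ∫ θ in (0 : ℝ)..2 * Real.pi, ((Circle.exp θ ^ n : Circle) : ℂ) = 0 := by
  have h1 : ∀ θ : ℝ, ((Circle.exp θ ^ n : Circle) : ℂ) = Complex.exp ((n * Complex.I) * θ) := by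
    intro θ
    rw [Circle.coe_zpow, Circle.coe_exp, ← Complex.exp_int_mul]
    ring_nf
  have h2 : (n * Complex.I : ℂ) ≠ 0 := mul_ne_zero (Int.cast_ne_zero.2 hn) Complex.I_ne_zero
  simp only [h1]
  rw [integral_exp_mul_complex h2]
  have h3 : (n * Complex.I : ℂ) * ((2 * Real.pi : ℝ) : ℂ) = n * (2 * Real.pi * Complex.I) := by
    push_cast; ring
  rw [h3, Complex.exp_int_mul_two_pi_mul_I]
  simp

/-- Averaging over the circle maps the closed span of the eigenvectors `e n i`, of weight `n`, into
the closed span of those of weight `0`. -/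
theorem integral_orbit_mem [CompleteSpace E] (hD : ∀ z T, ‖D z T‖ ≤ ‖T‖)
    (he : ∀ z n i, D z (e n i) = ((z ^ n : Circle) : ℂ) • e n i) {K : Submodule ℂ E}
    (hK : IsClosed (K : Set E)) (h0 : ∀ i, e 0 i ∈ K) {T : E}
    (hT : T ∈ (Submodule.span ℂ (Set.range (Function.uncurry e))).topologicalClosure) :
    ∫ θ in (0 : ℝ)..2 * Real.pi, D (Circle.exp θ) T ∈ K := by
  have hint : ∀ T ∈ (Submodule.span ℂ (Set.range (Function.uncurry e))).topologicalClosure,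
      IntervalIntegrable (fun θ : ℝ => D (Circle.exp θ) T) volume 0 (2 * Real.pi) := fun T hT =>
    ((continuous_orbit_of_mem_closure hD he hT).comp
      Circle.exp.continuous).intervalIntegrable _ _
  have hle := Submodule.le_topologicalClosure (Submodule.span ℂ (Set.range (Function.uncurry e)))
  have hspan : ∀ T ∈ Submodule.span ℂ (Set.range (Function.uncurry e)),
      ∫ θ in (0 : ℝ)..2 * Real.pi, D (Circle.exp θ) T ∈ K := by
    intro T hT
    induction hT using Submodule.span_induction with
    | mem _ h =>
      obtain ⟨⟨n, i⟩, rfl⟩ := h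
      simp only [Function.uncurry, he]
      rw [intervalIntegral.integral_smul_const]
      by_cases hn : n = 0
      · exact K.smul_mem _ (hn ▸ h0 i)
      · rw [integral_circle_exp_zpow hn, zero_smul]
        exact K.zero_mem
    | zero => simp
    | add S T hS hT h1 h2 =>
      simp only [map_add]
      rw [intervalIntegral.integral_add (hint S (hle hS)) (hint T (hle hT))]
      exact K.add_mem h1 h2
    | smul c _ _ h =>
      simp only [map_smul]
      rw [intervalIntegral.integral_smul]
      exact K.smul_mem c h
  change _ ∈ (K : Set E)
  rw [← hK.closure_eq, Metric.mem_closure_iff]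
  intro ε hε
  have hpi := Real.two_pi_pos
  obtain ⟨S, hS, hST⟩ := Metric.mem_closure_iff.1 hT (ε / (2 * Real.pi)) (by positivity)
  refine ⟨_, hspan S hS, ?_⟩
  rw [dist_eq_norm] at hST ⊢
  rw [← intervalIntegral.integral_sub (hint T hT) (hint S (hle hS))]
  simp only [← map_sub]
  refine (intervalIntegral.norm_integral_le_of_norm_le_const fun θ _ => hD _ _).trans_lt ?_
  rwa [sub_zero, abs_of_pos hpi, ← lt_div_iff₀ hpi]

/-- If a real functional `Φ` takes nonnegative values `‖g‖²` along the continuous path `f`, and the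
integral of `f` vanishes, then so does `g`. -/
theorem eq_zero_of_integral_eq_zero [CompleteSpace E] {F : Type*} [NormedAddCommGroup F]
    {f : ℝ → E} (hf : Continuous f) (Φ : E →L[ℝ] ℝ) {g : ℝ → F} (hg : Continuous g)
    (hΦ : ∀ θ, Φ (f θ) = ‖g θ‖ ^ 2) (h0 : ∫ θ in (0 : ℝ)..2 * Real.pi, f θ = 0) : g 0 = 0 := by
  have hz : ∫ θ in (0 : ℝ)..2 * Real.pi, ‖g θ‖ ^ 2 = 0 := by
    simp only [← hΦ]
    rw [Φ.intervalIntegral_comp_comm (hf.intervalIntegrable _ _), h0, map_zero]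
  by_contra hne
  refine (intervalIntegral.integral_pos Real.two_pi_pos (hg.norm.pow 2).continuousOn
    (fun θ _ => sq_nonneg _) ⟨0, ⟨le_rfl, Real.two_pi_pos.le⟩, ?_⟩).ne' hz
  exact pow_pos (norm_pos_iff.2 hne) 2

end Average

/-! ### The dual action of the circle on a crossed product by `ℤ` -/

namespace CrossedL1
variable {A : Type u} [CStarAlgebra A] {α : A ≃⋆ₐ[ℂ] A}

theorem hasSum_single (x : CrossedL1 α) :
    HasSum (fun n : ℤ => (single n (x n) : CrossedL1 α)) x :=
  lp.hasSum_single (E := fun _ : ℤ => A) ENNReal.one_ne_top x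

theorem single_mul_single (n m : ℤ) (a b : A) :
    (single n a * single m b : CrossedL1 α) = single (n + m) (a * (α ^ n) b) := by
  refine ext fun k => ?_
  rw [mul_apply, tsum_eq_single n]
  · simp only [single_apply, if_true]
    by_cases h : k = n + m
    · simp [h]
    · have : k - n ≠ m := fun h' => h (by rw [← h']; ring)
      simp [h, this]
  · intro l hl
    simp [single_apply, hl]

theorem star_single (n : ℤ) (a : A) :
    star (single n a : CrossedL1 α) = single (-n) ((α ^ (-n)) (star a)) := by
  refine ext fun k => ?_
  rw [star_apply, single_apply, single_apply]
  by_cases h : k = -n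
  · simp [h]
  · have : -k ≠ n := fun h' => h (by rw [← h']; ring)
    simp [h, this]

/-- The inclusion of the coefficient algebra into `ℓ¹(ℤ, A)`, as sequences supported at `0`. -/
noncomputable def coeff (α : A ≃⋆ₐ[ℂ] A) : A →⋆ₐ[ℂ] CrossedL1 α where
  toFun a := single 0 a
  map_one' := rfl
  map_mul' a b := by simp [single_mul_single]
  map_zero' := ext fun n => by simp [single_apply, zero_apply]
  map_add' a b := ext fun n => by rw [add_apply]; simp only [single_apply]; split_ifs <;> simp
  commutes' c := ext fun n => by
    rw [Algebra.algebraMap_eq_smul_one, Algebra.algebraMap_eq_smul_one, smul_apply, one_apply,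
      single_apply, smul_ite, smul_zero]
  map_star' a := by rw [star_single]; simp

/-- The dual action of `z ∈ 𝕋` on `ℓ¹(ℤ, A)`: the sequence `(xₙ)` is mapped to `(zⁿ xₙ)`. -/
noncomputable def gauge (z : Circle) : CrossedL1 α →⋆ₐ[ℂ] CrossedL1 α where
  toFun x := mk (fun n => ((z ^ n : Circle) : ℂ) • x n) (by
    simpa only [norm_smul, Circle.norm_coe, one_mul] using x.hasSum_norm.summable)
  map_one' := ext fun n => by
    rw [mk_apply, one_apply]
    split_ifs with h <;> simp [h]
  map_mul' x y := ext fun n => by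
    rw [mk_apply, mul_apply, mul_apply, ← (summable_conv x y n).tsum_const_smul]
    refine tsum_congr fun k => ?_
    rw [mk_apply, mk_apply, map_smul, smul_mul_smul_comm, ← Circle.coe_mul, ← zpow_add]
    congr 4
    ring
  map_zero' := ext fun n => by rw [mk_apply, zero_apply, smul_zero]
  map_add' x y := ext fun n => by rw [add_apply, mk_apply, mk_apply, mk_apply, add_apply, smul_add]
  commutes' c := ext fun n => by
    rw [mk_apply, Algebra.algebraMap_eq_smul_one, smul_apply, one_apply]
    split_ifs with h <;> simp [h]
  map_star' x := ext fun n => by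
    rw [mk_apply, star_apply, star_apply, mk_apply, star_smul, map_smul]
    congr 1
    rw [RCLike.star_def, ← Circle.coe_inv_eq_conj, zpow_neg, inv_inv]

theorem gauge_apply (z : Circle) (x : CrossedL1 α) (n : ℤ) :
    gauge z x n = ((z ^ n : Circle) : ℂ) • x n := rfl

theorem gauge_single (z : Circle) (n : ℤ) (a : A) :
    gauge z (single n a : CrossedL1 α) = ((z ^ n : Circle) : ℂ) • single n a := by
  refine ext fun k => ?_
  rw [gauge_apply, smul_apply, single_apply]
  split_ifs with h <;> simp [h]

end CrossedL1

section DualAction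
variable {A : Type u} [CStarAlgebra A] {α : A ≃⋆ₐ[ℂ] A}
open CrossedL1

/-- The composition of a representation with the dual action of `z` on `ℓ¹(ℤ, A)`. -/
@[reducible] noncomputable def CrossedRep.twist (π : CrossedRep α) (z : Circle) : CrossedRep α where
  H := π.H
  toHom := π.toHom.comp (gauge z)

variable (α) in
/-- Bounded families of operators, indexed by the representations of `ℓ¹(ℤ, A)`. -/
abbrev RepFamily : Type (u + 1) := lp (fun π : CrossedRep α => π.H →L[ℂ] π.H) ∞

/-- The dual action of `z` on families of operators. Since `π` and `π.twist z` act on the same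
space, it is given by moving the entry at `π.twist z` to `π`. -/
noncomputable def dualAction (z : Circle) : RepFamily α →L[ℂ] RepFamily α :=
  LinearMap.mkContinuous
    { toFun := fun T => ⟨fun π => T (π.twist z), memℓp_infty ⟨‖T‖, by
        rintro _ ⟨π, rfl⟩
        exact lp.norm_apply_le_norm ENNReal.top_ne_zero T (π.twist z)⟩⟩
      map_add' := fun S T => rfl
      map_smul' := fun c T => rfl } 1 (fun T => by
        rw [one_mul]
        exact lp.norm_le_of_forall_le (norm_nonneg _) fun π =>
          lp.norm_apply_le_norm ENNReal.top_ne_zero T (π.twist z))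

theorem norm_dualAction_le (z : Circle) (T : RepFamily α) : ‖dualAction z T‖ ≤ ‖T‖ :=
  lp.norm_le_of_forall_le (norm_nonneg _) fun π =>
    lp.norm_apply_le_norm ENNReal.top_ne_zero T (π.twist z)

theorem dualAction_universalRep (z : Circle) (x : CrossedL1 α) :
    dualAction z (universalRep α x) = universalRep α (gauge z x) := rfl

theorem dualAction_universalRep_single (z : Circle) (n : ℤ) (a : A) :
    dualAction z (universalRep α (single n a)) =
      ((z ^ n : Circle) : ℂ) • universalRep α (single n a) := by
  rw [dualAction_universalRep, gauge_single, map_smul]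

theorem norm_universalRep_le (x : CrossedL1 α) : ‖universalRep α x‖ ≤ ‖x‖ :=
  lp.norm_le_of_forall_le (norm_nonneg _) fun π => π.norm_apply_le x

theorem continuous_universalRep : Continuous (universalRep α) :=
  AddMonoidHomClass.continuous_of_bound (universalRep α) 1 fun x => by
    rw [one_mul]; exact norm_universalRep_le x

end DualAction

/-! ### Gauge-invariant uniqueness -/

section Uniqueness
variable {A : Type u} [CStarAlgebra A] {α : A ≃⋆ₐ[ℂ] A}
open CrossedL1

variable (α) in
/-- The element `a uⁿ` of the crossed product, where `u` is the unitary that implements `α`. -/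
noncomputable def weightVec (n : ℤ) (a : A) : RepFamily α := universalRep α (single n a)

variable (α) in
/-- The closed linear span of the elements `a uⁿ`. -/
noncomputable def crossedSpan : Submodule ℂ (RepFamily α) :=
  (Submodule.span ℂ (Set.range (Function.uncurry (weightVec α)))).topologicalClosure

theorem dualAction_weightVec (z : Circle) (n : ℤ) (a : A) :
    dualAction z (weightVec α n a) = ((z ^ n : Circle) : ℂ) • weightVec α n a :=
  dualAction_universalRep_single z n a

/-- A summable sequence is the sum of its terms, each of which is supported at one point; hence the
elements `a uⁿ` span a dense subspace of the crossed product. -/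
theorem mem_crossedSpan {T : RepFamily α}
    (hT : T ∈ (universalRep α).range.topologicalClosure) : T ∈ crossedSpan α := by
  refine closure_minimal ?_ isClosed_closure hT
  rintro _ ⟨x, rfl⟩
  have hx := x.hasSum_single.map (universalRep α) continuous_universalRep
  exact mem_closure_of_tendsto hx (Filter.Eventually.of_forall fun s =>
    Submodule.sum_mem _ fun n _ => Submodule.subset_span ⟨(n, x n), rfl⟩)

/-- The average over the circle of the dual action on `T`, up to the factor `2π`. -/
noncomputable def circleAverage (T : RepFamily α) : RepFamily α :=
  ∫ θ in (0 : ℝ)..2 * Real.pi, dualAction (Circle.exp θ) T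

theorem continuous_dualAction {T : RepFamily α} (hT : T ∈ crossedSpan α) :
    Continuous fun z : Circle => dualAction z T :=
  continuous_orbit_of_mem_closure (E := RepFamily α) (D := dualAction) (e := weightVec α)
    norm_dualAction_le dualAction_weightVec hT

theorem dualAction_one {T : RepFamily α} (hT : T ∈ crossedSpan α) : dualAction 1 T = T :=
  orbit_one_of_mem_closure (E := RepFamily α) (D := dualAction) (e := weightVec α)
    dualAction_weightVec hT

variable (α) in
/-- The coefficient algebra inside the crossed product. -/
noncomputable def coeffRep : A →⋆ₐ[ℂ] RepFamily α := (universalRep α).comp (coeff α)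

/-- Averaging over the dual action maps the crossed product into the coefficient algebra, provided
that the latter is faithfully represented (so that its image is closed). -/
theorem circleAverage_mem_range (hinj : Function.Injective (coeffRep α)) {T : RepFamily α}
    (hT : T ∈ crossedSpan α) : ∃ a : A, coeffRep α a = circleAverage T := by
  have hcl : IsClosed (Set.range (coeffRep α)) :=
    (NonUnitalStarAlgHom.isometry (coeffRep α) hinj).isClosedEmbedding.isClosed_range
  let K : Submodule ℂ (RepFamily α) := LinearMap.range (coeffRep α).toAlgHom.toLinearMap
  have h0 : ∀ a, weightVec α 0 a ∈ K := fun a => ⟨a, rfl⟩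
  exact integral_orbit_mem (E := RepFamily α) (D := dualAction) (e := weightVec α)
    norm_dualAction_le dualAction_weightVec (K := K) hcl h0 hT

/-- The entry at `π`, as a `*`-homomorphism. -/
noncomputable def evalRep (π : CrossedRep α) : RepFamily α →⋆ₐ[ℂ] (π.H →L[ℂ] π.H) where
  toFun T := T π
  map_one' := rfl
  map_mul' _ _ := rfl
  map_zero' := rfl
  map_add' _ _ := rfl
  commutes' _ := rfl
  map_star' _ := rfl

/-- The entry at `π`, as a continuous linear map. -/
noncomputable def entry (π : CrossedRep α) : RepFamily α →L[ℂ] (π.H →L[ℂ] π.H) :=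
  lp.evalCLM ℂ (fun π : CrossedRep α => π.H →L[ℂ] π.H) ∞ π

theorem entry_star_mul (π : CrossedRep α) (T : RepFamily α) :
    entry π (star T * T) = star (T π) * T π := rfl

/-- If bounded linear maps `W z` on the operators of the representation `π` multiply the images of
the elements `a uⁿ` by `zⁿ`, then they implement the dual action. In particular, the kernel of `π`
is invariant under the dual action. -/
theorem entry_dualAction_eq (π : CrossedRep α)
    (W : Circle → (π.H →L[ℂ] π.H) →L[ℂ] (π.H →L[ℂ] π.H))
    (hW : ∀ z n a, W z (π.toHom (single n a)) = ((z ^ n : Circle) : ℂ) • π.toHom (single n a))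
    (z : Circle) {T : RepFamily α} (hT : T ∈ crossedSpan α) :
    entry π (dualAction z T) = W z (entry π T) := by
  have h : Set.EqOn (entry π ∘L dualAction z) (W z ∘L entry π) (crossedSpan α) := by
    refine Set.EqOn.closure (fun T hT => ?_) (entry π ∘L dualAction z).continuous
      (W z ∘L entry π).continuous
    refine LinearMap.eqOn_span (f := (entry π ∘L dualAction z).toLinearMap)
      (g := (W z ∘L entry π).toLinearMap) ?_ hT
    rintro _ ⟨⟨n, a⟩, rfl⟩
    change entry π (dualAction z (weightVec α n a)) = W z (entry π (weightVec α n a))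
    rw [dualAction_weightVec, map_smul]
    exact (hW z n a).symm
  exact h hT

/-- The average over the dual action is faithful on positive elements. For a vector `v` of the
representation `π`, the entry at `π` of the average of `T⋆ T` satisfies
`⟪v, · v⟫ = ∫ ‖(z · T)_π v‖²`, and a continuous nonnegative function with vanishing integral
vanishes. -/
theorem eq_zero_of_circleAverage_star_mul {T : RepFamily α} (hT : T ∈ crossedSpan α)
    (hS : star T * T ∈ crossedSpan α) (h0 : circleAverage (star T * T) = 0) : T = 0 := by
  refine lp.ext (funext fun π => ContinuousLinearMap.ext fun v => ?_)
  let g : ℝ → π.H := fun θ => entry π (dualAction (Circle.exp θ) T) v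
  have hc : Continuous g :=
    ((ContinuousLinearMap.apply ℂ π.H v).continuous.comp (entry π).continuous).comp
      ((continuous_dualAction hT).comp Circle.exp.continuous)
  let φ : (π.H →L[ℂ] π.H) →L[ℝ] ℝ := Complex.reCLM ∘L
    ((innerSL ℂ v ∘L ContinuousLinearMap.apply ℂ π.H v).restrictScalars ℝ)
  let Φ : RepFamily α →L[ℝ] ℝ := φ ∘L (entry π).restrictScalars ℝ
  have hΦ : ∀ θ : ℝ, Φ (dualAction (Circle.exp θ) (star T * T)) = ‖g θ‖ ^ 2 := by
    intro θ
    change (inner ℂ v ((star (entry π (dualAction (Circle.exp θ) T)) *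
      entry π (dualAction (Circle.exp θ) T)) v)).re = _
    rw [mul_apply_eq_comp, ContinuousLinearMap.star_eq_adjoint,
      ContinuousLinearMap.adjoint_inner_right, inner_self_eq_norm_sq_to_K]
    norm_cast
  have h1 : g 0 = 0 := eq_zero_of_integral_eq_zero (E := RepFamily α)
    ((continuous_dualAction hS).comp Circle.exp.continuous) Φ hc hΦ h0
  have h2 : dualAction (Circle.exp 0) T = T := by rw [Circle.exp_zero]; exact dualAction_one hT
  exact (congrArg (fun T => entry π T v) h2).symm.trans h1

/-- The **gauge-invariant uniqueness theorem**: a representation that is faithful on the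
coefficient algebra, and on whose operators the dual action is implemented by bounded linear maps
`W z`, is faithful on the crossed product. No continuity of `W` in `z` is needed. -/
theorem eq_zero_of_evalRep_eq_zero (π₀ : CrossedRep α)
    (hinj : Function.Injective fun a : A => π₀.toHom (single 0 a))
    (W : Circle → (π₀.H →L[ℂ] π₀.H) →L[ℂ] (π₀.H →L[ℂ] π₀.H))
    (hW : ∀ z n a, W z (π₀.toHom (single n a)) =
      ((z ^ n : Circle) : ℂ) • π₀.toHom (single n a))
    {T : RepFamily α} (hT : T ∈ (universalRep α).range.topologicalClosure)
    (h0 : T π₀ = 0) : T = 0 := by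
  have hS : star T * T ∈ crossedSpan α := mem_crossedSpan (mul_mem (star_mem hT) hT)
  have hinj' : Function.Injective (coeffRep α) := fun a b hab =>
    hinj (congrArg (entry π₀) hab)
  refine eq_zero_of_circleAverage_star_mul (mem_crossedSpan hT) hS ?_
  -- the average of `T⋆ T` is an element of the coefficient algebra that `π₀` annihilates
  obtain ⟨a, ha⟩ := circleAverage_mem_range hinj' hS
  have h1 : entry π₀ (circleAverage (star T * T)) = 0 := by
    have h2 := (entry π₀).intervalIntegral_comp_comm (μ := volume) (a := 0) (b := 2 * Real.pi)
      (((continuous_dualAction hS).comp Circle.exp.continuous).intervalIntegrable _ _)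
    refine h2.symm.trans ?_
    refine (intervalIntegral.integral_congr fun θ _ => ?_).trans intervalIntegral.integral_zero
    refine (entry_dualAction_eq π₀ W hW _ hS).trans ?_
    rw [entry_star_mul, h0, mul_zero, map_zero]
  rw [← ha] at h1 ⊢
  have h3 : a = 0 := hinj (h1.trans (map_zero (π₀.toHom.comp (coeff α))).symm)
  rw [h3, map_zero]

/-- Under the assumptions of the gauge-invariant uniqueness theorem, the crossed product is
isomorphic to the norm closure of the range of the representation of `ℓ¹(ℤ, A)`. The evaluation at
this representation is injective on the crossed product, hence isometric with closed range. -/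
theorem nonempty_crossedProduct_equiv {H : Type u} [NormedAddCommGroup H] [InnerProductSpace ℂ H]
    [CompleteSpace H] [Nontrivial H] (ρ : CrossedL1 α →⋆ₐ[ℂ] (H →L[ℂ] H))
    (hinj : Function.Injective fun a : A => ρ (single 0 a))
    (W : Circle → (H →L[ℂ] H) →L[ℂ] (H →L[ℂ] H))
    (hW : ∀ z n a, W z (ρ (single n a)) = ((z ^ n : Circle) : ℂ) • ρ (single n a)) :
    Nonempty (CrossedProduct α ≃⋆ₐ[ℂ] ρ.range.topologicalClosure) := by
  -- `ρ` is one of the representations of which the universal one consists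
  let π₀ : CrossedRep α := { H := H, toHom := ρ }
  let ψ : CrossedProduct α →⋆ₐ[ℂ] (H →L[ℂ] H) :=
    (evalRep π₀).comp (universalRep α).range.topologicalClosure.subtype
  have hψ : Function.Injective ψ := by
    refine (injective_iff_map_eq_zero ψ).2 fun T hT => ?_
    exact Subtype.ext (eq_zero_of_evalRep_eq_zero π₀ hinj W hW T.2 hT)
  have hcl : IsClosed (ψ.range : Set (H →L[ℂ] H)) :=
    (NonUnitalStarAlgHom.isometry ψ hψ).isClosedEmbedding.isClosed_range
  have hr : ψ.range = ρ.range.topologicalClosure := by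
    refine le_antisymm ?_ (closure_minimal ?_ hcl)
    · rintro _ ⟨T, rfl⟩
      refine map_mem_closure (f := entry π₀) (entry π₀).continuous T.2 ?_
      rintro _ ⟨x, rfl⟩
      exact ⟨x, rfl⟩
    · rintro _ ⟨x, rfl⟩
      exact ⟨⟨universalRep α x, subset_closure ⟨x, rfl⟩⟩, rfl⟩
  exact ⟨(StarAlgEquiv.ofInjective ψ hψ).trans (hr ▸ StarAlgEquiv.refl ℂ _)⟩

theorem CrossedRep.norm_le {H : Type u} [NormedAddCommGroup H] [InnerProductSpace ℂ H]
    [CompleteSpace H] [Nontrivial H] (ρ : CrossedL1 α →⋆ₐ[ℂ] (H →L[ℂ] H)) (x : CrossedL1 α) :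
    ‖ρ x‖ ≤ ‖x‖ :=
  CrossedRep.norm_apply_le { H := H, toHom := ρ } x

end Uniqueness

/-! ### The integrated form of a covariant representation -/

namespace CrossedL1
variable {A B : Type*} [CStarAlgebra A] [CStarAlgebra B] {α : A ≃⋆ₐ[ℂ] A}

/-- The covariance relation `φ(α(a)) U = U φ(a)` extends to all integer powers. -/
theorem covariant_zpow {φ : A →⋆ₐ[ℂ] B} {U : unitary B}
    (h : ∀ a, φ (α a) * (U : B) = U * φ a) (n : ℤ) (a : A) :
    φ ((α ^ n) a) * ((U ^ n : unitary B) : B) = ((U ^ n : unitary B) : B) * φ a := by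
  induction n using Int.induction_on generalizing a with
  | zero => simp
  | succ n ih =>
    have h1 : (α ^ ((n : ℤ) + 1)) a = (α ^ (n : ℤ)) (α a) := by rw [zpow_add_one]; rfl
    rw [h1, zpow_add_one, Submonoid.coe_mul, ← mul_assoc, ih, mul_assoc, h, mul_assoc]
  | pred n ih =>
    have h1 : (α ^ (-(n : ℤ) - 1)) a = (α ^ (-(n : ℤ))) (α⁻¹ a) := by rw [zpow_sub_one]; rfl
    have h2 : φ (α⁻¹ a) * ((U⁻¹ : unitary B) : B) = ((U⁻¹ : unitary B) : B) * φ a := by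
      have h3 : α (α⁻¹ a) = a := (congrArg (fun f : A ≃⋆ₐ[ℂ] A => f a) (mul_inv_cancel α))
      have h4 := h (α⁻¹ a)
      rw [h3] at h4
      have h5 : ((U⁻¹ : unitary B) : B) * U = 1 := by rw [← Submonoid.coe_mul]; simp
      have h6 : (U : B) * ((U⁻¹ : unitary B) : B) = 1 := by rw [← Submonoid.coe_mul]; simp
      calc _ = ((U⁻¹ : unitary B) : B) * U * φ (α⁻¹ a) * ((U⁻¹ : unitary B) : B) := by
            rw [h5, one_mul]
        _ = ((U⁻¹ : unitary B) : B) * φ a * (U * ((U⁻¹ : unitary B) : B)) := by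
            rw [mul_assoc _ (U : B), ← h4]; simp only [mul_assoc]
        _ = _ := by rw [h6, mul_one]
    rw [h1, zpow_sub_one, Submonoid.coe_mul, ← mul_assoc, ih, mul_assoc, h2, mul_assoc]

theorem norm_covariant_le (φ : A →⋆ₐ[ℂ] B) (U : unitary B) (a : A) :
    ‖φ a * (U : B)‖ ≤ ‖a‖ := by
  rw [CStarRing.norm_mul_mem_unitary _ U.2]
  exact NonUnitalStarAlgHom.norm_apply_le φ a

theorem summable_integrated (φ : A →⋆ₐ[ℂ] B) (U : unitary B) (x : CrossedL1 α) :
    Summable fun n : ℤ => ‖φ (x n) * ((U ^ n : unitary B) : B)‖ :=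
  x.hasSum_norm.summable.of_nonneg_of_le (fun _ => norm_nonneg _)
    fun n => norm_covariant_le φ (U ^ n) (x n)

/-- The Cauchy product of absolutely summable series indexed by `ℤ`. -/
theorem tsum_mul_tsum_int {R : Type*} [NormedRing R] [CompleteSpace R] {f g : ℤ → R}
    (hf : Summable fun n => ‖f n‖) (hg : Summable fun n => ‖g n‖) :
    (∑' n, f n) * ∑' n, g n = ∑' n, ∑' k, f k * g (n - k) := by
  have hs : Summable fun p : ℤ × ℤ => f p.1 * g p.2 := summable_mul_of_summable_norm hf hg
  have hs' : Summable fun p : ℤ × ℤ => f p.2 * g (p.1 - p.2) := shear.summable_iff.2 hs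
  rw [tsum_mul_tsum_of_summable_norm hf hg, ← shear.tsum_eq (fun p : ℤ × ℤ => f p.1 * g p.2)]
  exact hs'.tsum_prod

theorem map_conv (φ : A →⋆ₐ[ℂ] B) (x y : CrossedL1 α) (n : ℤ) (b : B) :
    φ ((x * y) n) * b = ∑' k, φ (x k * (α ^ k) (y (n - k))) * b := by
  have hφ : Continuous φ := AddMonoidHomClass.continuous_of_bound φ 1 fun a => by
    rw [one_mul]; exact NonUnitalStarAlgHom.norm_apply_le φ a
  rw [mul_apply, (summable_conv x y n).map_tsum φ hφ]
  exact (((summable_conv x y n).map φ hφ).tsum_mul_right b).symm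

theorem integrated_mul (φ : A →⋆ₐ[ℂ] B) (U : unitary B)
    (h : ∀ a, φ (α a) * (U : B) = U * φ a) (x y : CrossedL1 α) :
    ∑' n : ℤ, φ ((x * y) n) * ((U ^ n : unitary B) : B) =
      (∑' n : ℤ, φ (x n) * ((U ^ n : unitary B) : B)) *
        ∑' n : ℤ, φ (y n) * ((U ^ n : unitary B) : B) := by
  rw [tsum_mul_tsum_int (summable_integrated φ U x) (summable_integrated φ U y)]
  refine tsum_congr fun n => ?_
  rw [map_conv]
  refine tsum_congr fun k => ?_
  have h2 : ((U ^ n : unitary B) : B) =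
      ((U ^ k : unitary B) : B) * ((U ^ (n - k) : unitary B) : B) := by
    rw [← Submonoid.coe_mul, ← zpow_add, add_sub_cancel]
  rw [map_mul, h2, mul_assoc, ← mul_assoc (φ ((α ^ k) (y (n - k)))), covariant_zpow h]
  simp only [mul_assoc]

theorem integrated_star (φ : A →⋆ₐ[ℂ] B) (U : unitary B)
    (h : ∀ a, φ (α a) * (U : B) = U * φ a) (x : CrossedL1 α) :
    ∑' n : ℤ, φ ((star x) n) * ((U ^ n : unitary B) : B) =
      star (∑' n : ℤ, φ (x n) * ((U ^ n : unitary B) : B)) := by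
  rw [tsum_star]
  refine ((Equiv.neg ℤ).tsum_eq _).symm.trans (tsum_congr fun n => ?_)
  rw [Equiv.neg_apply, star_apply, neg_neg, covariant_zpow h, star_mul,
    map_star φ, zpow_neg]
  rfl

/-- The integrated form `x ↦ ∑ₙ φ(xₙ) Uⁿ` of a covariant pair `(φ, U)`. -/
noncomputable def integrated (φ : A →⋆ₐ[ℂ] B) (U : unitary B)
    (h : ∀ a, φ (α a) * (U : B) = U * φ a) : CrossedL1 α →⋆ₐ[ℂ] B where
  toFun x := ∑' n : ℤ, φ (x n) * ((U ^ n : unitary B) : B)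
  map_one' := by
    rw [tsum_eq_single 0]
    · simp [one_apply]
    · intro n hn; simp [one_apply, hn]
  map_zero' := by simp [zero_apply]
  map_add' x y := by
    rw [← (summable_integrated φ U x).of_norm.tsum_add (summable_integrated φ U y).of_norm]
    exact tsum_congr fun n => by rw [add_apply, map_add, add_mul]
  commutes' c := by
    rw [tsum_eq_single 0]
    · rw [Algebra.algebraMap_eq_smul_one, Algebra.algebraMap_eq_smul_one, smul_apply, one_apply]
      simp
    · intro n hn
      rw [Algebra.algebraMap_eq_smul_one, smul_apply, one_apply]
      simp [hn]
  map_mul' := integrated_mul φ U h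
  map_star' := integrated_star φ U h

theorem integrated_single (φ : A →⋆ₐ[ℂ] B) (U : unitary B)
    (h : ∀ a, φ (α a) * (U : B) = U * φ a) (n : ℤ) (a : A) :
    integrated φ U h (single n a) = φ a * ((U ^ n : unitary B) : B) := by
  change ∑' m : ℤ, φ ((single n a : CrossedL1 α) m) * ((U ^ m : unitary B) : B) = _
  rw [tsum_eq_single n]
  · simp [single_apply]
  · intro m hm; simp [single_apply, hm]

end CrossedL1

/-! ### Multiplication operators and changes of variable on `L²` -/

section Scalar
variable {X E : Type*} [TopologicalSpace X] [NormedAddCommGroup E]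

theorem scalarFun_apply [NormedSpace ℂ E] (p : X →ᵇ ℂ) (x : X) (v : E) :
    scalarFun E p x v = p x • v := rfl

theorem scalarFun_mul_comm [NormedSpace ℂ E] (p : X →ᵇ ℂ) (f : X →ᵇ (E →L[ℂ] E)) :
    scalarFun E p * f = f * scalarFun E p := by
  ext x v
  exact ((f x).map_smul (p x) v).symm

variable [InnerProductSpace ℂ E] [CompleteSpace E]

/-- `p ↦ p · I` as a `*`-homomorphism. -/
noncomputable def scalarFunHom : (X →ᵇ ℂ) →⋆ₐ[ℂ] (X →ᵇ (E →L[ℂ] E)) where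
  toFun := scalarFun E
  map_one' := by ext x v; exact one_smul ℂ v
  map_mul' p q := by ext x v; exact mul_smul (p x) (q x) v
  map_zero' := by ext x v; exact zero_smul ℂ v
  map_add' p q := by ext x v; exact add_smul (p x) (q x) v
  commutes' c := by
    ext x v
    change (algebraMap ℂ (X →ᵇ ℂ) c) x • v = c • v
    rfl
  map_star' p := by
    ext x v
    rw [BoundedContinuousFunction.star_apply]
    refine ext_inner_right ℂ fun w => ?_
    rw [ContinuousLinearMap.star_eq_adjoint, ContinuousLinearMap.adjoint_inner_left,
      scalarFun_apply, scalarFun_apply, inner_smul_left, inner_smul_right,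
      BoundedContinuousFunction.star_apply]
    simp

end Scalar

section Mult
variable {X E : Type*} [TopologicalSpace X] [SecondCountableTopology X] [MeasurableSpace X]
  [OpensMeasurableSpace X] [NormedAddCommGroup E] [InnerProductSpace ℂ E] [CompleteSpace E]

theorem inner_multOp_star (μ : Measure X) (f : X →ᵇ (E →L[ℂ] E)) (u v : Lp E 2 μ) :
    inner ℂ (multOp μ (star f) u) v = inner ℂ u (multOp μ f v) := by
  rw [L2.inner_def, L2.inner_def]
  refine integral_congr_ae ?_
  filter_upwards [multOp_ae μ (star f) u, multOp_ae μ f v] with x h1 h2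
  rw [h1, h2, BoundedContinuousFunction.star_apply, ContinuousLinearMap.star_eq_adjoint,
    ContinuousLinearMap.adjoint_inner_left]

/-- `f ↦ f(M)` as a `*`-homomorphism. -/
noncomputable def multOpHom (μ : Measure X) :
    (X →ᵇ (E →L[ℂ] E)) →⋆ₐ[ℂ] (Lp E 2 μ →L[ℂ] Lp E 2 μ) where
  toFun := multOp μ
  map_one' := by
    refine ContinuousLinearMap.ext fun u => Lp.ext ?_
    filter_upwards [multOp_ae μ 1 u] with x h
    rw [h]; rfl
  map_mul' f g := by
    refine ContinuousLinearMap.ext fun u => Lp.ext ?_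
    rw [mul_apply_eq_comp]
    filter_upwards [multOp_ae μ (f * g) u, multOp_ae μ f (multOp μ g u), multOp_ae μ g u]
      with x h1 h2 h3
    rw [h1, h2, h3]; rfl
  map_zero' := by
    refine ContinuousLinearMap.ext fun u => Lp.ext ?_
    filter_upwards [multOp_ae μ 0 u, Lp.coeFn_zero E 2 μ] with x h1 h2
    exact h1.trans h2.symm
  map_add' f g := by
    refine ContinuousLinearMap.ext fun u => Lp.ext ?_
    rw [add_apply]
    filter_upwards [multOp_ae μ (f + g) u, multOp_ae μ f u, multOp_ae μ g u,
      Lp.coeFn_add (multOp μ f u) (multOp μ g u)] with x h1 h2 h3 h4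
    rw [h1, h4, Pi.add_apply, h2, h3]; rfl
  commutes' c := by
    refine ContinuousLinearMap.ext fun u => Lp.ext ?_
    rw [Algebra.algebraMap_eq_smul_one (A := Lp E 2 μ →L[ℂ] Lp E 2 μ),
      smul_apply]
    filter_upwards [multOp_ae μ (algebraMap ℂ (X →ᵇ (E →L[ℂ] E)) c) u,
      Lp.coeFn_smul c u] with x h1 h2
    rw [h1]
    refine Eq.trans ?_ h2.symm
    rfl
  map_star' f := by
    rw [ContinuousLinearMap.star_eq_adjoint]
    exact (ContinuousLinearMap.eq_adjoint_iff _ _).2 fun u v => inner_multOp_star μ f u v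

theorem multOpHom_apply (μ : Measure X) (f : X →ᵇ (E →L[ℂ] E)) : multOpHom μ f = multOp μ f := rfl

/-- The operator `f(M)` determines `f`: applied to the indicator function of a ball times a vector
`v`, it determines `τ ↦ f(τ) v` almost everywhere on the ball, hence everywhere, by continuity. -/
theorem multOpHom_injective :
    Function.Injective (multOpHom (E := E) (volume : Measure ℝ)) := by
  refine (injective_iff_map_eq_zero _).2 fun f hf => ?_
  ext x v
  have hcont : Continuous fun τ => f τ v :=
    (ContinuousLinearMap.apply ℂ E v).continuous.comp f.continuous
  have h : ∀ N : ℕ, ∀ᵐ τ : ℝ, τ ∈ Metric.ball (0 : ℝ) N → f τ v = 0 := by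
    intro N
    have hN : volume (Metric.ball (0 : ℝ) N) ≠ ∞ := measure_ball_lt_top.ne
    have h1 := multOp_ae volume f (indicatorConstLp 2 measurableSet_ball hN v)
    rw [← multOpHom_apply, hf, zero_apply] at h1
    filter_upwards [h1, Lp.coeFn_zero E 2 (volume : Measure ℝ),
      indicatorConstLp_coeFn (p := 2) (hs := measurableSet_ball) (hμs := hN) (c := v)]
      with τ h2 h3 h4 hτ
    rw [h4, h3, Set.indicator_of_mem hτ] at h2
    exact h2.symm
  have h0 : (fun τ => f τ v) =ᵐ[volume] fun _ => (0 : E) := by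
    filter_upwards [ae_all_iff.2 h] with τ hτ
    obtain ⟨N, hN⟩ := exists_nat_gt ‖τ‖
    exact hτ N (by simpa using hN)
  exact congrFun ((hcont.ae_eq_iff_eq volume continuous_const).1 h0) x

end Mult

section ChangeOfVariable
variable {X : Type*} [MeasurableSpace X] {μ : Measure X}
  (E : Type*) [NormedAddCommGroup E] [InnerProductSpace ℂ E]

/-- The unitary `u ↦ u ∘ e` of `L²`, for a measure preserving bijection `e`. -/
noncomputable def compUnitary (e : X ≃ᵐ X) (he : MeasurePreserving e μ μ) :
    Lp E 2 μ ≃ₗᵢ[ℂ] Lp E 2 μ where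
  toLinearEquiv := LinearEquiv.ofLinearMap (Lp.compMeasurePreservingₗ ℂ e he)
    (Lp.compMeasurePreservingₗ ℂ e.symm (he.symm e))
    (LinearMap.ext fun u => by
      change Lp.compMeasurePreserving e he (Lp.compMeasurePreserving e.symm (he.symm e) u) = u
      refine Lp.ext ?_
      filter_upwards [Lp.coeFn_compMeasurePreserving
        (Lp.compMeasurePreserving e.symm (he.symm e) u) he,
        he.quasiMeasurePreserving.ae (Lp.coeFn_compMeasurePreserving u (he.symm e))] with x h1 h2
      rw [h1, Function.comp_apply, h2, Function.comp_apply, e.symm_apply_apply])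
    (LinearMap.ext fun u => by
      change Lp.compMeasurePreserving e.symm (he.symm e) (Lp.compMeasurePreserving e he u) = u
      refine Lp.ext ?_
      filter_upwards [Lp.coeFn_compMeasurePreserving
        (Lp.compMeasurePreserving e he u) (he.symm e),
        (he.symm e).quasiMeasurePreserving.ae (Lp.coeFn_compMeasurePreserving u he)] with x h1 h2
      rw [h1, Function.comp_apply, h2, Function.comp_apply, e.apply_symm_apply])
  norm_map' u := Lp.norm_compMeasurePreserving u he

variable {E}

theorem compUnitary_ae (e : X ≃ᵐ X) (he : MeasurePreserving e μ μ) (u : Lp E 2 μ) :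
    compUnitary E e he u =ᵐ[μ] fun x => u (e x) :=
  Lp.coeFn_compMeasurePreserving u he

theorem multOp_compUnitary [TopologicalSpace X] [SecondCountableTopology X]
    [OpensMeasurableSpace X] (e : X ≃ᵐ X) (he : MeasurePreserving e μ μ)
    {f g : X →ᵇ (E →L[ℂ] E)} (hfg : ∀ x, g (e x) = f x) (u : Lp E 2 μ) :
    multOp μ f (compUnitary E e he u) = compUnitary E e he (multOp μ g u) := by
  refine Lp.ext ?_
  filter_upwards [multOp_ae μ f (compUnitary E e he u), compUnitary_ae e he u,
    compUnitary_ae e he (multOp μ g u), he.quasiMeasurePreserving.ae (multOp_ae μ g u)]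
    with x h1 h2 h3 h4
  rw [h1, h2, h3, h4, hfg]

/-- The translations `u ↦ u(· - s)` of `L²(ℝ; E)`, as a representation of `ℝ`. -/
noncomputable def translation : Multiplicative ℝ →* (Lp E 2 (volume : Measure ℝ) ≃ₗᵢ[ℂ]
    Lp E 2 (volume : Measure ℝ)) where
  toFun s := compUnitary E (MeasurableEquiv.subRight s.toAdd) (measurePreserving_sub_right _ _)
  map_one' := by
    refine LinearIsometryEquiv.ext fun u => Lp.ext ?_
    filter_upwards [compUnitary_ae (MeasurableEquiv.subRight (0 : ℝ))
      (measurePreserving_sub_right volume _) u] with x h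
    refine h.trans ?_
    change u (x - 0) = u x
    rw [sub_zero]
  map_mul' s t := by
    refine LinearIsometryEquiv.ext fun u => Lp.ext ?_
    filter_upwards [compUnitary_ae (MeasurableEquiv.subRight (s.toAdd + t.toAdd))
      (measurePreserving_sub_right volume _) u,
      compUnitary_ae (MeasurableEquiv.subRight s.toAdd) (measurePreserving_sub_right volume _)
        (compUnitary E (MeasurableEquiv.subRight t.toAdd) (measurePreserving_sub_right _ _) u),
      (measurePreserving_sub_right volume s.toAdd).quasiMeasurePreserving.ae
        (compUnitary_ae (MeasurableEquiv.subRight t.toAdd)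
          (measurePreserving_sub_right volume _) u)] with x h1 h2 h3
    refine h1.trans (Eq.trans ?_ (h2.trans h3).symm)
    change u (x - (s.toAdd + t.toAdd)) = u (x - s.toAdd - t.toAdd)
    rw [sub_sub]

theorem translation_ae (s : ℝ) (u : Lp E 2 (volume : Measure ℝ)) :
    translation (Multiplicative.ofAdd s) u =ᵐ[volume] fun τ => u (τ - s) :=
  compUnitary_ae _ (measurePreserving_sub_right volume s) u

theorem multOp_translation (s : ℝ) {f g : ℝ →ᵇ (E →L[ℂ] E)} (hfg : ∀ τ, g (τ - s) = f τ)
    (u : Lp E 2 (volume : Measure ℝ)) :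
    multOp volume f (translation (Multiplicative.ofAdd s) u) =
      translation (Multiplicative.ofAdd s) (multOp volume g u) :=
  multOp_compUnitary _ (measurePreserving_sub_right volume s) hfg u

/-- The character `τ ↦ e^{iθτ}`. -/
noncomputable def expFun (θ : ℝ) : ℝ →ᵇ ℂ :=
  BoundedContinuousFunction.ofNormedAddCommGroup
    (fun τ : ℝ => Complex.exp (((θ * τ : ℝ) : ℂ) * Complex.I)) (by fun_prop) 1
    (fun τ => (Complex.norm_exp_ofReal_mul_I _).le)

theorem expFun_apply (θ τ : ℝ) :
    expFun θ τ = Complex.exp (((θ * τ : ℝ) : ℂ) * Complex.I) := rfl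

theorem expFun_mul_star (θ : ℝ) : expFun θ * star (expFun θ) = 1 := by
  ext τ
  rw [BoundedContinuousFunction.mul_apply, BoundedContinuousFunction.star_apply, expFun_apply,
    RCLike.star_def, RCLike.mul_conj, Complex.norm_exp_ofReal_mul_I]
  simp

/-- The Weyl commutation relation: `e^{iθτ}` times the translation by `s` is the translation by `s`
times `e^{iθs} e^{iθτ}`. -/
theorem expFun_translation (θ s : ℝ) (u : Lp E 2 (volume : Measure ℝ)) :
    multOp volume (scalarFun E (expFun θ)) (translation (Multiplicative.ofAdd s) u) =
      Complex.exp (((θ * s : ℝ) : ℂ) * Complex.I) • translation (Multiplicative.ofAdd s)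
        (multOp volume (scalarFun E (expFun θ)) u) := by
  refine Lp.ext ?_
  filter_upwards [multOp_ae volume (scalarFun E (expFun θ))
      (translation (Multiplicative.ofAdd s) u), translation_ae s u,
    Lp.coeFn_smul (Complex.exp (((θ * s : ℝ) : ℂ) * Complex.I))
      (translation (Multiplicative.ofAdd s) (multOp volume (scalarFun E (expFun θ)) u)),
    translation_ae s (multOp volume (scalarFun E (expFun θ)) u),
    (measurePreserving_sub_right volume s).quasiMeasurePreserving.ae
      (multOp_ae volume (scalarFun E (expFun θ)) u)] with τ h1 h2 h3 h4 h5
  rw [h1, h2, h3, Pi.smul_apply, h4, h5, scalarFun_apply, scalarFun_apply, smul_smul,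
    expFun_apply, expFun_apply, ← Complex.exp_add]
  congr 2
  push_cast
  ring

variable [CompleteSpace E]

/-- The translation `u ↦ u(· - 1)` of `L²(ℝ; E)`, as a unitary operator. -/
noncomputable def shiftUnitary :
    unitary (Lp E 2 (volume : Measure ℝ) →L[ℂ] Lp E 2 (volume : Measure ℝ)) :=
  Unitary.linearIsometryEquiv.symm (translation (Multiplicative.ofAdd 1))

theorem shiftUnitary_zpow (n : ℤ) (u : Lp E 2 (volume : Measure ℝ)) :
    ((shiftUnitary (E := E) ^ n : unitary (Lp E 2 (volume : Measure ℝ) →L[ℂ] _)) :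
      Lp E 2 (volume : Measure ℝ) →L[ℂ] Lp E 2 (volume : Measure ℝ)) u =
      translation (Multiplicative.ofAdd (n : ℝ)) u := by
  have h : (Multiplicative.ofAdd (n : ℝ)) = (Multiplicative.ofAdd (1 : ℝ)) ^ n := by
    rw [← ofAdd_zsmul]; simp
  rw [h, map_zpow, shiftUnitary, ← map_zpow]
  rfl

/-- The action of `e^{iθ}` on operators by conjugation with the multiplication by `e^{iθτ}`: it
fixes multiplication operators and multiplies the translation by `n` by `e^{iθn}`. -/
noncomputable def gaugeConj (θ : ℝ) :
    (Lp E 2 (volume : Measure ℝ) →L[ℂ] Lp E 2 (volume : Measure ℝ)) →L[ℂ]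
      (Lp E 2 (volume : Measure ℝ) →L[ℂ] Lp E 2 (volume : Measure ℝ)) :=
  (ContinuousLinearMap.mul ℂ _ (multOp volume (scalarFun E (expFun θ)))) ∘L
    ((ContinuousLinearMap.mul ℂ _).flip (multOp volume (scalarFun E (star (expFun θ)))))

theorem gaugeConj_apply (θ : ℝ) (f : ℝ →ᵇ (E →L[ℂ] E)) (n : ℤ) :
    gaugeConj θ (multOp volume f * ((shiftUnitary (E := E) ^ n : unitary _) :
      Lp E 2 (volume : Measure ℝ) →L[ℂ] Lp E 2 (volume : Measure ℝ))) =
      Complex.exp (((θ * n : ℝ) : ℂ) * Complex.I) • (multOp volume f *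
        ((shiftUnitary (E := E) ^ n : unitary _) :
      Lp E 2 (volume : Measure ℝ) →L[ℂ] Lp E 2 (volume : Measure ℝ))) := by
  refine ContinuousLinearMap.ext fun u => ?_
  change multOp volume (scalarFun E (expFun θ)) (multOp volume f
    (((shiftUnitary (E := E) ^ n : unitary _) : Lp E 2 (volume : Measure ℝ) →L[ℂ]
      Lp E 2 (volume : Measure ℝ)) (multOp volume (scalarFun E (star (expFun θ))) u))) =
    Complex.exp (((θ * n : ℝ) : ℂ) * Complex.I) • multOp volume f
      (((shiftUnitary (E := E) ^ n : unitary _) : Lp E 2 (volume : Measure ℝ) →L[ℂ]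
      Lp E 2 (volume : Measure ℝ)) u)
  have h1 : ∀ v, multOp volume (scalarFun E (expFun θ)) (multOp volume f v) =
      multOp volume f (multOp volume (scalarFun E (expFun θ)) v) := by
    intro v
    have h := congrArg (multOpHom (volume : Measure ℝ)) (scalarFun_mul_comm (expFun θ) f)
    rw [map_mul, map_mul] at h
    exact congrArg (fun T : Lp E 2 (volume : Measure ℝ) →L[ℂ] Lp E 2 (volume : Measure ℝ) => T v) h
  have h2 : multOp volume (scalarFun E (expFun θ))
      (multOp volume (scalarFun E (star (expFun θ))) u) = u := by
    have h := congrArg ((multOpHom (volume : Measure ℝ)).comp (scalarFunHom (E := E)))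
      (expFun_mul_star θ)
    rw [map_mul, map_one] at h
    exact congrArg (fun T : Lp E 2 (volume : Measure ℝ) →L[ℂ] Lp E 2 (volume : Measure ℝ) => T u) h
  rw [h1, shiftUnitary_zpow, shiftUnitary_zpow, expFun_translation, h2, map_smul]

end ChangeOfVariable

/-! ### Intertwining relations of the Fourier transform -/

section FourierRelations
variable {E : Type*} [NormedAddCommGroup E] [InnerProductSpace ℂ E]

/-- Continuous identities on `L²(ℝ; E)` may be verified on Schwartz functions. -/
theorem eq_of_eq_on_schwartz {Y : Type*} [TopologicalSpace Y] [T2Space Y]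
    {S T : Lp E 2 (volume : Measure ℝ) → Y} (hS : Continuous S) (hT : Continuous T)
    (h : ∀ f : SchwartzMap ℝ E, S (f.toLp 2) = T (f.toLp 2)) (u : Lp E 2 (volume : Measure ℝ)) :
    S u = T u := by
  have hd := SchwartzMap.denseRange_toLpCLM (E := ℝ) (F := E) (p := 2) (μ := volume)
    ENNReal.ofNat_ne_top
  exact congrFun (hd.equalizer hS hT (funext h)) u

theorem schwartz_toLp_ae (f : SchwartzMap ℝ E) : ∀ᵐ t : ℝ, f.toLp 2 volume t = f t :=
  SchwartzMap.coeFn_toLp _ _ _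

theorem exists_schwartz_dilation (k : ℂ) {c : ℝ} (hc : c ≠ 0) (f : SchwartzMap ℝ E) :
    ∃ g : SchwartzMap ℝ E, ∀ t, g t = k • f (c * t) := by
  refine ⟨k • SchwartzMap.compCLMOfContinuousLinearEquiv ℂ
    (ContinuousLinearEquiv.unitsEquivAut ℝ (Units.mk0 c hc)) f, fun t => ?_⟩
  rw [mul_comm]
  rfl

open FourierTransform in
/-- The Fourier transform of a dilated function. -/
theorem fourier_comp_mul_left {c : ℝ} (hc : 0 < c) (k : ℂ) (g h : ℝ → E)
    (hg : ∀ t, g t = k • h (c * t)) (τ : ℝ) :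
    𝓕 g (c * τ) = k • ((c⁻¹ : ℝ) : ℂ) • 𝓕 h τ := by
  rw [Real.fourier_eq', Real.fourier_eq', Complex.coe_smul]
  have h5 := Measure.integral_comp_mul_left (fun s : ℝ =>
    Complex.exp (((-2 * Real.pi * inner ℝ s τ : ℝ) : ℂ) * Complex.I) • h s) c
  rw [abs_of_pos (inv_pos.2 hc)] at h5
  rw [← h5, ← integral_smul]
  refine integral_congr_ae (Filter.Eventually.of_forall fun t => ?_)
  simp only [hg, RCLike.inner_apply, conj_trivial]
  rw [smul_comm]
  congr 4
  push_cast
  ring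

variable (E) in
/-- The reflection `u ↦ u(-·)` of `L²(ℝ; E)`. -/
noncomputable def reflection :
    Lp E 2 (volume : Measure ℝ) ≃ₗᵢ[ℂ] Lp E 2 (volume : Measure ℝ) :=
  compUnitary E (MeasurableEquiv.neg ℝ) (Measure.measurePreserving_neg volume)

theorem reflection_ae (u : Lp E 2 (volume : Measure ℝ)) :
    reflection E u =ᵐ[volume] fun t => u (-t) :=
  compUnitary_ae (MeasurableEquiv.neg ℝ) (Measure.measurePreserving_neg volume) u

variable [CompleteSpace E]

/-- The Fourier transform commutes with constant operators. -/
theorem unitaryFourier_const (a : E →L[ℂ] E) (u : Lp E 2 (volume : Measure ℝ)) :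
    unitaryFourier E (multOp volume (BoundedContinuousFunction.const ℝ a) u) =
      multOp volume (BoundedContinuousFunction.const ℝ a) (unitaryFourier E u) := by
  refine eq_of_eq_on_schwartz
    (S := fun u => unitaryFourier E (multOp volume (BoundedContinuousFunction.const ℝ a) u))
    (T := fun u => multOp volume (BoundedContinuousFunction.const ℝ a) (unitaryFourier E u))
    ((unitaryFourier E).continuous.comp (multOp volume _).continuous)
    ((multOp volume _).continuous.comp (unitaryFourier E).continuous) (fun f => ?_) u
  have h1 : multOp volume (BoundedContinuousFunction.const ℝ a) (f.toLp 2) =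
      (SchwartzMap.postcompCLM a f).toLp 2 := by
    refine Lp.ext ?_
    filter_upwards [multOp_ae volume (BoundedContinuousFunction.const ℝ a) (f.toLp 2),
      f.coeFn_toLp 2, (SchwartzMap.postcompCLM a f).coeFn_toLp 2] with t h1 h2 h3
    rw [h1, h2, h3]; rfl
  change unitaryFourier E (multOp volume (BoundedContinuousFunction.const ℝ a) (f.toLp 2)) =
    multOp volume (BoundedContinuousFunction.const ℝ a) (unitaryFourier E (f.toLp 2))
  rw [h1]
  refine Lp.ext ?_
  filter_upwards [unitaryFourier_schwartz E (SchwartzMap.postcompCLM a f),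
    multOp_ae volume (BoundedContinuousFunction.const ℝ a) (unitaryFourier E (f.toLp 2)),
    unitaryFourier_schwartz E f] with τ h1 h2 h3
  rw [h1, h2, h3, BoundedContinuousFunction.const_apply, map_smul]
  congr 1
  have hint : Integrable (fun t : ℝ => Complex.exp (-(Complex.I * t * τ)) • f t) := by
    have hc : Continuous fun t : ℝ => Complex.exp (-(Complex.I * t * τ)) • f t :=
      Continuous.smul (by fun_prop) f.continuous
    refine (f.integrable (μ := volume)).mono hc.aestronglyMeasurable
      (Filter.Eventually.of_forall fun t => ?_)
    have : -(Complex.I * t * τ) = ((-(t * τ) : ℝ) : ℂ) * Complex.I := by push_cast; ring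
    rw [norm_smul, this, Complex.norm_exp_ofReal_mul_I, one_mul]
  rw [← ContinuousLinearMap.integral_comp_comm a hint]
  refine integral_congr_ae (Filter.Eventually.of_forall fun t => ?_)
  simp

/-- The Fourier transform turns translations into multiplications by characters. -/
theorem unitaryFourier_translation (s : ℝ) (u : Lp E 2 (volume : Measure ℝ)) :
    unitaryFourier E (translation (Multiplicative.ofAdd s) u) =
      multOp volume (scalarFun E (expFun (-s))) (unitaryFourier E u) := by
  refine eq_of_eq_on_schwartz
    (S := fun u => unitaryFourier E (translation (Multiplicative.ofAdd s) u))
    (T := fun u => multOp volume (scalarFun E (expFun (-s))) (unitaryFourier E u))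
    ((unitaryFourier E).continuous.comp (translation _).continuous)
    ((multOp volume _).continuous.comp (unitaryFourier E).continuous) (fun f => ?_) u
  have h1 : translation (Multiplicative.ofAdd s) (f.toLp 2) =
      (SchwartzMap.compSubConstCLM ℂ s f).toLp 2 := by
    refine Lp.ext ?_
    filter_upwards [translation_ae s (f.toLp 2),
      (measurePreserving_sub_right volume s).quasiMeasurePreserving.ae (schwartz_toLp_ae f),
      (SchwartzMap.compSubConstCLM ℂ s f).coeFn_toLp 2] with t h1 h2 h3
    rw [h1, h2, h3]; rfl
  change unitaryFourier E (translation (Multiplicative.ofAdd s) (f.toLp 2)) =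
    multOp volume (scalarFun E (expFun (-s))) (unitaryFourier E (f.toLp 2))
  rw [h1]
  refine Lp.ext ?_
  filter_upwards [unitaryFourier_schwartz E (SchwartzMap.compSubConstCLM ℂ s f),
    multOp_ae volume (scalarFun E (expFun (-s))) (unitaryFourier E (f.toLp 2)),
    unitaryFourier_schwartz E f] with τ h1 h2 h3
  rw [h1, h2, h3, scalarFun_apply, smul_comm]
  congr 1
  rw [← integral_smul, ← integral_add_right_eq_self _ s]
  refine integral_congr_ae (Filter.Eventually.of_forall fun t => ?_)
  simp only [SchwartzMap.compSubConstCLM_apply, add_sub_cancel_right, expFun_apply, smul_smul,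
    ← Complex.exp_add]
  congr 2
  push_cast
  ring

open FourierTransform in
/-- On Schwartz functions, the unitary Fourier transform is a dilation of Mathlib's, whose kernel is
`e^{-2πitτ}`. -/
theorem unitaryFourier_toLp_ae (f : SchwartzMap ℝ E) :
    unitaryFourier E (f.toLp 2) =ᵐ[volume] fun τ =>
      ((Real.sqrt (2 * Real.pi)⁻¹ : ℝ) : ℂ) • (𝓕 f : SchwartzMap ℝ E) ((2 * Real.pi)⁻¹ * τ) := by
  have h1 : unitaryFourier E (f.toLp 2) = dilation (2 * Real.pi)⁻¹ (inv_pos.2 Real.two_pi_pos)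
      ((𝓕 f : SchwartzMap ℝ E).toLp 2) := by
    rw [← SchwartzMap.toLp_fourier_eq]; rfl
  rw [h1]
  filter_upwards [dilation_ae (2 * Real.pi)⁻¹ (inv_pos.2 Real.two_pi_pos)
      ((𝓕 f : SchwartzMap ℝ E).toLp 2),
    ae_dilation (2 * Real.pi)⁻¹ (inv_pos.2 Real.two_pi_pos) (schwartz_toLp_ae (𝓕 f))] with τ h2 h3
  rw [h2, h3]

open FourierTransform in
theorem fourier_fourier_schwartz (f : SchwartzMap ℝ E) (τ : ℝ) :
    𝓕 (𝓕 f : SchwartzMap ℝ E) τ = f (-τ) := by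
  have h9 : (𝓕⁻ (𝓕 f : SchwartzMap ℝ E) : SchwartzMap ℝ E) = f :=
    FourierTransform.fourierInv_fourier_eq f
  conv_rhs => rw [← h9]
  rw [SchwartzMap.fourierInv_coe, Real.fourierInv_eq_fourier_neg, neg_neg, SchwartzMap.fourier_coe]

open FourierTransform in
theorem unitaryFourier_unitaryFourier_toLp (f : SchwartzMap ℝ E) :
    unitaryFourier E (unitaryFourier E (f.toLp 2)) = reflection E (f.toLp 2) := by
  have hpi := Real.two_pi_pos
  obtain ⟨g, hg'⟩ := exists_schwartz_dilation ((Real.sqrt (2 * Real.pi)⁻¹ : ℝ) : ℂ)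
    (inv_ne_zero hpi.ne') (𝓕 f)
  have hg : unitaryFourier E (f.toLp 2) = g.toLp 2 := by
    refine Lp.ext ?_
    filter_upwards [unitaryFourier_toLp_ae f, schwartz_toLp_ae g] with τ h1 h2
    rw [h1, h2, hg']
  have h4 : ∀ τ, (𝓕 g : SchwartzMap ℝ E) ((2 * Real.pi)⁻¹ * τ) =
      ((Real.sqrt (2 * Real.pi)⁻¹ : ℝ) : ℂ) • (((2 * Real.pi)⁻¹⁻¹ : ℝ) : ℂ) • f (-τ) := by
    intro τ
    rw [SchwartzMap.fourier_coe, fourier_comp_mul_left (inv_pos.2 hpi) _ _ _ hg',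
      ← SchwartzMap.fourier_coe, fourier_fourier_schwartz]
  have h10 : ((Real.sqrt (2 * Real.pi)⁻¹ : ℝ) : ℂ) * ((Real.sqrt (2 * Real.pi)⁻¹ : ℝ) : ℂ) *
      (((2 * Real.pi)⁻¹⁻¹ : ℝ) : ℂ) = 1 := by
    rw [← Complex.ofReal_mul, ← Complex.ofReal_mul,
      Real.mul_self_sqrt (inv_pos.2 hpi).le, mul_inv_cancel₀ (inv_ne_zero hpi.ne'),
      Complex.ofReal_one]
  rw [hg]
  refine Lp.ext ?_
  filter_upwards [unitaryFourier_toLp_ae g, reflection_ae (f.toLp 2),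
    (Measure.measurePreserving_neg (volume : Measure ℝ)).quasiMeasurePreserving.ae
      (schwartz_toLp_ae f)] with τ h1 h2 h3
  rw [h1, h2, h3, h4, smul_smul, smul_smul, h10, one_smul]

/-- Fourier inversion: the square of the Fourier transform is the reflection. -/
theorem unitaryFourier_unitaryFourier (u : Lp E 2 (volume : Measure ℝ)) :
    unitaryFourier E (unitaryFourier E u) = reflection E u :=
  eq_of_eq_on_schwartz (S := fun u => unitaryFourier E (unitaryFourier E u))
    ((unitaryFourier E).continuous.comp (unitaryFourier E).continuous)
    (reflection E).continuous unitaryFourier_unitaryFourier_toLp u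

end FourierRelations

/-! ### Translation invariance of the symbol algebra -/

section Symbols

/-- Scalar symbols `m(τ, j)`, bounded and continuous in `τ` uniformly in `j`. -/
abbrev ScalarSymbol : Type := ℝ →ᵇ lp (fun _ : ℤ => ℂ) ∞

/-- Operator-valued symbols. -/
abbrev OpSymbol : Type := ℝ →ᵇ (L2S →L[ℂ] L2S)

theorem circleMultiplier_ext {S T : L2S →L[ℂ] L2S}
    (h : ∀ u j, fourierCoeff (S u) j = fourierCoeff (T u) j) : S = T := by
  refine ContinuousLinearMap.ext fun u => fourierBasis.repr.injective (lp.ext (funext fun j => ?_))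
  rw [fourierBasis_repr, fourierBasis_repr, h]

/-- The multiplier map `m ↦ F_d⁻¹ m F_d` is multiplicative. -/
noncomputable def multiplierHom : ScalarSymbol →ₐ[ℂ] OpSymbol :=
  AlgHom.ofLinearMap (circleMultiplier.compLeftContinuousBounded ℝ).toLinearMap
    (by
      ext1 τ
      refine circleMultiplier_ext fun u j => ?_
      change fourierCoeff (circleMultiplier 1 u) j = fourierCoeff u j
      rw [circleMultiplier_fourierCoeff]
      exact one_mul _)
    (fun m n => by
      ext1 τ
      refine circleMultiplier_ext fun u j => ?_
      change fourierCoeff (circleMultiplier (m τ * n τ) u) j =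
        fourierCoeff (circleMultiplier (m τ) (circleMultiplier (n τ) u)) j
      rw [circleMultiplier_fourierCoeff, circleMultiplier_fourierCoeff,
        circleMultiplier_fourierCoeff, ← mul_assoc]
      rfl)

theorem continuous_multiplierHom : Continuous multiplierHom :=
  (circleMultiplier.compLeftContinuousBounded ℝ).continuous

/-- Evaluation of a scalar symbol at a point. -/
noncomputable def evalSymbol (τ : ℝ) (j : ℤ) : ScalarSymbol →ₐ[ℂ] ℂ where
  toFun m := m τ j
  map_one' := rfl
  map_mul' _ _ := rfl
  map_zero' := rfl
  map_add' _ _ := rfl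
  commutes' c := by rw [Algebra.algebraMap_eq_smul_one]; exact mul_one c

theorem evalSymbol_apply (τ : ℝ) (j : ℤ) (m : ScalarSymbol) : evalSymbol τ j m = m τ j := rfl

theorem norm_symbol_le {m : ScalarSymbol} {C : ℝ} (hC : 0 ≤ C) (h : ∀ τ j, ‖m τ j‖ ≤ C) :
    ‖m‖ ≤ C :=
  (BoundedContinuousFunction.norm_le hC).2 fun τ => lp.norm_le_of_forall_le hC fun j => h τ j

/-- A closed algebra of symbols that contains `m` and the real symbol `h`, with values in a
compact interval `[c, d]` with `c > 0`, contains `m h^{-1/2}`. This follows from the Weierstrass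
theorem for the function `x ↦ x^{-1/2}` on `[c, d]`. -/
theorem mul_inv_sqrt_mem (S : Subalgebra ℂ ScalarSymbol) (hS : IsClosed (S : Set ScalarSymbol))
    {c d : ℝ} (hc : 0 < c) {m h M : ScalarSymbol} {h' : ℝ → ℤ → ℝ} (hm : m ∈ S) (hh : h ∈ S)
    (hval : ∀ τ j, h τ j = (h' τ j : ℂ)) (hmem : ∀ τ j, h' τ j ∈ Set.Icc c d)
    (hM : ∀ τ j, M τ j = m τ j * (((Real.sqrt (h' τ j))⁻¹ : ℝ) : ℂ)) : M ∈ S := by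
  change M ∈ (S : Set ScalarSymbol)
  rw [← hS.closure_eq, Metric.mem_closure_iff]
  intro ε hε
  -- an error `δ` in `x^{-1/2}` becomes an error at most `‖m‖ δ` in the symbol
  have hpos : 0 < ‖m‖ + 1 := by positivity
  obtain ⟨p, hp⟩ := exists_polynomial_near_of_continuousOn c d (fun x => (Real.sqrt x)⁻¹)
    (Real.continuous_sqrt.continuousOn.inv₀ fun x hx =>
      (Real.sqrt_pos.2 (hc.trans_le hx.1)).ne') (ε / (2 * (‖m‖ + 1))) (by positivity)
  refine ⟨m * Polynomial.aeval h (p.map (algebraMap ℝ ℂ)),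
    S.mul_mem hm (Algebra.adjoin_le (Set.singleton_subset_iff.2 hh)
      (Polynomial.aeval_mem_adjoin_singleton ℂ h)), ?_⟩
  rw [dist_eq_norm]
  refine (norm_symbol_le (C := ε / 2) (by positivity) fun τ j => ?_).trans_lt (half_lt_self hε)
  have h1 : (M - m * Polynomial.aeval h (p.map (algebraMap ℝ ℂ))) τ j =
      m τ j * (((Real.sqrt (h' τ j))⁻¹ - p.eval (h' τ j) : ℝ) : ℂ) := by
    rw [← evalSymbol_apply, map_sub, map_mul, ← Polynomial.aeval_algHom_apply, evalSymbol_apply,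
      evalSymbol_apply, evalSymbol_apply, hM, hval, Polynomial.aeval_map_algebraMap,
      Complex.ofReal_sub, mul_sub]
    congr 2
    exact Polynomial.aeval_algebraMap_apply_eq_algebraMap_eval (h' τ j) p
  have h2 : ‖m τ j‖ ≤ ‖m‖ + 1 :=
    ((lp.norm_apply_le_norm ENNReal.top_ne_zero (m τ) j).trans (m.norm_coe_le_norm τ)).trans
      (by linarith)
  have h3 := hp _ (hmem τ j)
  rw [h1, norm_mul, Complex.norm_real, Real.norm_eq_abs, abs_sub_comm]
  calc _ ≤ (‖m‖ + 1) * (ε / (2 * (‖m‖ + 1))) :=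
        mul_le_mul h2 h3.le (abs_nonneg _) hpos.le
    _ = ε / 2 := by field_simp

/-- The translate `τ ↦ f(τ - s)` of an operator-valued symbol. -/
noncomputable def translateSymbol (s : ℝ) (f : OpSymbol) : OpSymbol :=
  f.compContinuous ⟨fun τ => τ - s, by fun_prop⟩

theorem translateSymbol_multiplierHom (s : ℝ) (m : ScalarSymbol) :
    translateSymbol s (multiplierHom m) =
      multiplierHom (m.compContinuous ⟨fun τ => τ - s, by fun_prop⟩) := rfl

theorem exists_symbol_BΛ : ∃ m : ScalarSymbol, BΛ = multiplierHom m ∧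
    ∀ τ j, m τ j = (((bracket τ j)⁻¹ : ℝ) : ℂ) := by
  rw [BΛ]
  exact ⟨_, rfl, fun τ j => symbolFun_apply _ _ _ τ j⟩

theorem exists_symbol_Bt : ∃ m : ScalarSymbol, Bt = multiplierHom m ∧
    ∀ τ j, m τ j = ((τ * (bracket τ j)⁻¹ : ℝ) : ℂ) := by
  rw [Bt]
  exact ⟨_, rfl, fun τ j => symbolFun_apply _ _ _ τ j⟩

theorem exists_symbol_Bβ : ∃ m : ScalarSymbol, Bβ = multiplierHom m ∧
    ∀ τ j, m τ j = (((j : ℝ) * (bracket τ j)⁻¹ : ℝ) : ℂ) := by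
  rw [Bβ]
  exact ⟨_, rfl, fun τ j => symbolFun_apply _ _ _ τ j⟩

theorem bracket_pos (τ : ℝ) (j : ℤ) : 0 < bracket τ j := by linarith [one_le_bracket τ j]

/-- The translation of `(1 + τ² + j²)^{-1/2}` multiplies it by `h^{-1/2}`, where
`h = 1 - 2sτ(1 + τ² + j²)⁻¹ + s²(1 + τ² + j²)⁻¹` is the quotient
`(1 + (τ - s)² + j²)/(1 + τ² + j²)`. -/
theorem bracket_sub_inv (s τ : ℝ) (j : ℤ) :
    (bracket (τ - s) j)⁻¹ = (bracket τ j)⁻¹ *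
      (Real.sqrt (1 - 2 * s * ((bracket τ j)⁻¹ * (τ * (bracket τ j)⁻¹)) +
        s ^ 2 * ((bracket τ j)⁻¹ * (bracket τ j)⁻¹)))⁻¹ := by
  have h1 := bracket_pos τ j
  have h2 := bracket_pos (τ - s) j
  have h3 : 1 - 2 * s * ((bracket τ j)⁻¹ * (τ * (bracket τ j)⁻¹)) +
        s ^ 2 * ((bracket τ j)⁻¹ * (bracket τ j)⁻¹) = (bracket (τ - s) j / bracket τ j) ^ 2 := by
    rw [div_pow, bracket_sq (τ - s)]
    have := bracket_sq τ j
    field_simp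
    linear_combination this
  rw [h3, Real.sqrt_sq (by positivity)]
  field_simp

/-- The quotient `(1 + (τ - s)² + j²)/(1 + τ² + j²)` stays away from `0` and `∞`. -/
theorem bracket_quotient_mem {s : ℝ} (hs : |s| = 1) (τ : ℝ) (j : ℤ) :
    1 - 2 * s * ((bracket τ j)⁻¹ * (τ * (bracket τ j)⁻¹)) +
        s ^ 2 * ((bracket τ j)⁻¹ * (bracket τ j)⁻¹) ∈ Set.Icc (1 / 3 : ℝ) 4 := by
  have h1 := bracket_pos τ j
  have h2 := bracket_sq τ j
  have hs2 : s ^ 2 = 1 := by rw [← sq_abs, hs, one_pow]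
  have h3 : 1 - 2 * s * ((bracket τ j)⁻¹ * (τ * (bracket τ j)⁻¹)) +
        s ^ 2 * ((bracket τ j)⁻¹ * (bracket τ j)⁻¹) =
      (1 + (τ - s) ^ 2 + (j : ℝ) ^ 2) / bracket τ j ^ 2 := by
    field_simp
    linear_combination h2
  rw [h3, h2]
  have h4 : 0 < 1 + τ ^ 2 + (j : ℝ) ^ 2 := by positivity
  constructor
  · rw [le_div_iff₀ h4]
    nlinarith [sq_nonneg (2 * τ - 3 * s), sq_nonneg (j : ℝ)]
  · rw [div_le_iff₀ h4]
    nlinarith [sq_nonneg (τ + s), sq_nonneg (j : ℝ)]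

/-- A closed algebra of scalar symbols that contains the symbols `l`, `t`, `b` of `Λ`, `-i∂ₜΛ` and
`-i∂_βΛ` contains their translates by `±1`. These are `l`, `t - s l` and `b` times `h^{-1/2}`, where
`h = 1 - 2s l t + s² l²` is bounded below by a positive constant. -/
theorem translate_mem_of_mem (S : Subalgebra ℂ ScalarSymbol)
    (hS : IsClosed (S : Set ScalarSymbol)) {s : ℝ} (hs : |s| = 1) {l t b : ScalarSymbol}
    (hl : ∀ τ j, l τ j = (((bracket τ j)⁻¹ : ℝ) : ℂ))
    (ht : ∀ τ j, t τ j = ((τ * (bracket τ j)⁻¹ : ℝ) : ℂ))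
    (hb : ∀ τ j, b τ j = (((j : ℝ) * (bracket τ j)⁻¹ : ℝ) : ℂ))
    (hlS : l ∈ S) (htS : t ∈ S) (hbS : b ∈ S) {m : ScalarSymbol} (hm : m = l ∨ m = t ∨ m = b) :
    m.compContinuous ⟨fun τ => τ - s, by fun_prop⟩ ∈ S := by
  let h : ScalarSymbol := 1 - (2 * s : ℂ) • (l * t) + (s ^ 2 : ℂ) • (l * l)
  have hhS : h ∈ S := S.add_mem (S.sub_mem S.one_mem (S.smul_mem (S.mul_mem hlS htS) _))
    (S.smul_mem (S.mul_mem hlS hlS) _)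
  have hh : ∀ τ j, h τ j = ((1 - 2 * s * ((bracket τ j)⁻¹ * (τ * (bracket τ j)⁻¹)) +
      s ^ 2 * ((bracket τ j)⁻¹ * (bracket τ j)⁻¹) : ℝ) : ℂ) := by
    intro τ j
    rw [← evalSymbol_apply]
    simp only [h, map_add, map_sub, map_one, map_smul, map_mul, evalSymbol_apply, hl, ht,
      smul_eq_mul]
    push_cast
    ring
  have key := fun {m M : ScalarSymbol} (hm : m ∈ S) hM =>
    mul_inv_sqrt_mem S hS (M := M) (by norm_num) hm hhS hh (bracket_quotient_mem hs) hM
  have hshift : ∀ (m : ScalarSymbol) (τ : ℝ) (j : ℤ),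
      m.compContinuous ⟨fun τ => τ - s, by fun_prop⟩ τ j = m (τ - s) j := fun _ _ _ => rfl
  rcases hm with rfl | rfl | rfl
  · refine key hlS fun τ j => ?_
    rw [hshift, hl, hl, bracket_sub_inv, Complex.ofReal_mul]
  · refine key (S.sub_mem htS (S.smul_mem hlS (s : ℂ))) fun τ j => ?_
    rw [hshift, ht, bracket_sub_inv, ← evalSymbol_apply τ j (m - (s : ℂ) • l), map_sub, map_smul,
      evalSymbol_apply, evalSymbol_apply, hl, ht, smul_eq_mul]
    push_cast
    ring
  · refine key hbS fun τ j => ?_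
    rw [hshift, hb, hb, bracket_sub_inv, ← mul_assoc, Complex.ofReal_mul]

end Symbols

/-! ### The algebra `ℬ†` -/

section Dagger

/-- The symbol `τ ↦ f(-τ)`. -/
noncomputable def reflectSymbol (f : OpSymbol) : OpSymbol :=
  f.compContinuous ⟨fun τ => -τ, by fun_prop⟩

theorem reflectSymbol_multiplierHom (m : ScalarSymbol) :
    reflectSymbol (multiplierHom m) =
      multiplierHom (m.compContinuous ⟨fun τ => -τ, by fun_prop⟩) := rfl

theorem scalarSymbol_ext {m n : ScalarSymbol} (h : ∀ τ j, m τ j = n τ j) : m = n :=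
  BoundedContinuousFunction.ext fun τ => lp.ext (funext (h τ))

theorem bracket_neg (τ : ℝ) (j : ℤ) : bracket (-τ) j = bracket τ j := by
  rw [bracket, bracket, neg_sq]

theorem reflectSymbol_BΛ : reflectSymbol BΛ = BΛ := by
  obtain ⟨m, hm, hm'⟩ := exists_symbol_BΛ
  rw [hm, reflectSymbol_multiplierHom]
  refine congrArg multiplierHom (scalarSymbol_ext fun τ j => ?_)
  change m (-τ) j = m τ j
  rw [hm', hm', bracket_neg]

theorem reflectSymbol_Bt : reflectSymbol Bt = -Bt := by
  obtain ⟨m, hm, hm'⟩ := exists_symbol_Bt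
  rw [hm, reflectSymbol_multiplierHom]
  refine (congrArg multiplierHom (scalarSymbol_ext (n := -m) fun τ j => ?_)).trans
    (map_neg multiplierHom m)
  change m (-τ) j = -m τ j
  rw [hm', hm', bracket_neg, neg_mul, Complex.ofReal_neg]

theorem reflectSymbol_Bβ : reflectSymbol Bβ = Bβ := by
  obtain ⟨m, hm, hm'⟩ := exists_symbol_Bβ
  rw [hm, reflectSymbol_multiplierHom]
  refine congrArg multiplierHom (scalarSymbol_ext fun τ j => ?_)
  change m (-τ) j = m τ j
  rw [hm', hm', bracket_neg]

theorem fourierConj_opA (a : C(S1, ℂ)) : fourierConj (opA a) = opA a := by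
  refine ContinuousLinearMap.ext fun u => ?_
  rw [fourierConj_apply, LinearIsometryEquiv.symm_apply_eq]
  exact (unitaryFourier_const _ u).symm

/-- Since the square of the Fourier transform is the reflection, `F⁻¹ (F⁻¹ f(M) F) F` is the
multiplication by the reflected symbol. -/
theorem fourierConj_fourierMultOp (f : OpSymbol) :
    fourierConj (fourierMultOp f) = multOp volume (reflectSymbol f) := by
  refine ContinuousLinearMap.ext fun u => ?_
  rw [fourierConj_apply, LinearIsometryEquiv.symm_apply_eq]
  change fourierF.symm (multOp volume f (fourierF (fourierF u))) = _
  rw [LinearIsometryEquiv.symm_apply_eq]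
  refine (congrArg (multOp volume f) (unitaryFourier_unitaryFourier u)).trans
    (Eq.trans ?_ (unitaryFourier_unitaryFourier _).symm)
  refine multOp_compUnitary _ _ (fun τ => ?_) u
  change f (-(-τ)) = f τ
  rw [neg_neg]

theorem fourierConj_opP_expFun (s : ℝ) (u : L2Ω) :
    fourierConj (opP (expFun (-s))) u = translation (Multiplicative.ofAdd s) u := by
  rw [fourierConj_apply, LinearIsometryEquiv.symm_apply_eq]
  exact (unitaryFourier_translation s u).symm

theorem fourierConj_mem_algBDagger {T : BoundedOps} (hT : T ∈ algDagger) :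
    fourierConj T ∈ algBDagger := ⟨T, hT, rfl⟩

theorem mem_algDagger_of_gen {T : BoundedOps}
    (hT : T ∈ {T | ∃ a : C(S1, ℂ),
        ContDiff ℝ ((⊤ : ℕ∞) : WithTop ℕ∞) (fun β : ℝ => a (β : S1)) ∧ T = opA a} ∪
      {opΛ, opDt, opDβ}) : T ∈ algDagger :=
  StarSubalgebra.le_topologicalClosure _ (StarAlgebra.subset_adjoin ℂ _ hT)

theorem opA_mem_algBDagger {a : C(S1, ℂ)}
    (ha : ContDiff ℝ ((⊤ : ℕ∞) : WithTop ℕ∞) (fun β : ℝ => a (β : S1))) :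
    opA a ∈ algBDagger := by
  rw [← fourierConj_opA]
  exact fourierConj_mem_algBDagger (mem_algDagger_of_gen (Or.inl ⟨a, ha, rfl⟩))

theorem multOp_BΛ_mem : multOp volume BΛ ∈ algBDagger := by
  rw [← reflectSymbol_BΛ, ← fourierConj_fourierMultOp]
  exact fourierConj_mem_algBDagger (mem_algDagger_of_gen (Or.inr (Or.inl rfl)))

theorem multOp_Bt_mem : multOp volume Bt ∈ algBDagger := by
  have h : multOp volume (-Bt) ∈ algBDagger := by
    rw [← reflectSymbol_Bt, ← fourierConj_fourierMultOp]
    exact fourierConj_mem_algBDagger (mem_algDagger_of_gen (Or.inr (Or.inr (Or.inl rfl))))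
  rw [← multOpHom_apply, map_neg, multOpHom_apply] at h
  exact neg_mem_iff.1 h

theorem multOp_Bβ_mem : multOp volume Bβ ∈ algBDagger := by
  rw [← reflectSymbol_Bβ, ← fourierConj_fourierMultOp]
  exact fourierConj_mem_algBDagger (mem_algDagger_of_gen (Or.inr (Or.inr (Or.inr rfl))))

theorem continuous_fourierConj : Continuous fourierConj :=
  (StarAlgEquiv.isometry fourierConj).continuous

/-- `ℬ†` is the smallest closed `*`-algebra that contains the multiplications by the constants
`a(M_x)` and by the symbols of `Λ`, `-i∂ₜΛ` and `-i∂_βΛ`. The reflection of the symbols is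
immaterial, because it changes them at most by a sign. -/
theorem algBDagger_le {S : StarSubalgebra ℂ BoundedOps} (hS : IsClosed (S : Set BoundedOps))
    (hA : ∀ a : C(S1, ℂ), ContDiff ℝ ((⊤ : ℕ∞) : WithTop ℕ∞) (fun β : ℝ => a (β : S1)) → opA a ∈ S)
    (hΛ : multOp volume BΛ ∈ S) (ht : multOp volume Bt ∈ S) (hβ : multOp volume Bβ ∈ S) :
    algBDagger ≤ S := by
  have h : algDagger ≤ S.comap (fourierConj : BoundedOps →⋆ₐ[ℂ] BoundedOps) := by
    refine StarSubalgebra.topologicalClosure_minimal (StarAlgebra.adjoin_le ?_)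
      (hS.preimage continuous_fourierConj)
    rintro T (⟨a, ha, rfl⟩ | rfl | rfl | rfl)
    · change fourierConj (opA a) ∈ S
      rw [fourierConj_opA]
      exact hA a ha
    · change fourierConj (fourierMultOp BΛ) ∈ S
      rw [fourierConj_fourierMultOp, reflectSymbol_BΛ]
      exact hΛ
    · change fourierConj (fourierMultOp Bt) ∈ S
      rw [fourierConj_fourierMultOp, reflectSymbol_Bt, ← multOpHom_apply, map_neg]
      exact neg_mem ht
    · change fourierConj (fourierMultOp Bβ) ∈ S
      rw [fourierConj_fourierMultOp, reflectSymbol_Bβ]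
      exact hβ
  rintro _ ⟨T, hT, rfl⟩
  exact h hT

/-- Every element of `ℬ†` is the multiplication by a bounded norm-continuous function: these
operators form a closed algebra, because `f ↦ f(M)` is isometric. -/
theorem exists_multOp_of_mem {B : BoundedOps} (hB : B ∈ algBDagger) :
    ∃ f : OpSymbol, B = multOp volume f := by
  have hcl : IsClosed ((multOpHom (E := L2S) (volume : Measure ℝ)).range : Set BoundedOps) :=
    (NonUnitalStarAlgHom.isometry (multOpHom (E := L2S) (volume : Measure ℝ))
      multOpHom_injective).isClosedEmbedding.isClosed_range
  obtain ⟨f, hf⟩ := algBDagger_le hcl (fun a _ => ⟨_, rfl⟩) ⟨_, rfl⟩ ⟨_, rfl⟩ ⟨_, rfl⟩ hB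
  exact ⟨f, hf.symm⟩

/-- Conjugation of operators with the translation by `s`. -/
noncomputable def translationConj (s : ℝ) : BoundedOps ≃⋆ₐ[ℂ] BoundedOps :=
  (translation (E := L2S) (Multiplicative.ofAdd s)).conjStarAlgEquiv

theorem translationConj_apply (s : ℝ) (T : BoundedOps) (u : L2Ω) :
    translationConj s T (translation (Multiplicative.ofAdd s) u) =
      translation (Multiplicative.ofAdd s) (T u) := by
  change translation (Multiplicative.ofAdd s) (T ((translation (Multiplicative.ofAdd s)).symm
    (translation (Multiplicative.ofAdd s) u))) = _
  rw [LinearIsometryEquiv.symm_apply_apply]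

theorem translationConj_neg (s : ℝ) (T : BoundedOps) :
    translationConj (-s) (translationConj s T) = T := by
  have h : translation (E := L2S) (Multiplicative.ofAdd (-s)) =
      (translation (Multiplicative.ofAdd s)).symm := by
    rw [ofAdd_neg, map_inv]; rfl
  rw [translationConj, h]
  exact (translationConj s).symm_apply_apply T

theorem translationConj_multOp (s : ℝ) (f : OpSymbol) :
    translationConj s (multOp volume f) = multOp volume (translateSymbol s f) := by
  refine ContinuousLinearMap.ext fun u => ?_
  obtain ⟨v, rfl⟩ := (translation (Multiplicative.ofAdd s)).surjective u
  rw [translationConj_apply]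
  exact (multOp_translation s (fun τ => rfl) v).symm

/-- The scalar symbols of operators in `ℬ†`. -/
noncomputable def daggerSymbols : Subalgebra ℂ ScalarSymbol :=
  algBDagger.toSubalgebra.comap
    ((multOpHom (E := L2S) (volume : Measure ℝ)).toAlgHom.comp multiplierHom)

theorem mem_daggerSymbols {m : ScalarSymbol} :
    m ∈ daggerSymbols ↔ multOp volume (multiplierHom m) ∈ algBDagger := Iff.rfl

theorem isClosed_daggerSymbols : IsClosed (daggerSymbols : Set ScalarSymbol) := by
  have h : Continuous (multOpHom (E := L2S) (volume : Measure ℝ)) :=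
    (NonUnitalStarAlgHom.isometry (multOpHom (E := L2S) (volume : Measure ℝ))
      multOpHom_injective).continuous
  exact isClosed_algBDagger.preimage (h.comp continuous_multiplierHom)

/-- `ℬ†` is invariant under the translations by `±1`: the generators `a(M_x)` are fixed, and the
translates of the others are again symbols of elements of `ℬ†`. -/
theorem translationConj_mem {s : ℝ} (hs : |s| = 1) {B : BoundedOps} (hB : B ∈ algBDagger) :
    translationConj s B ∈ algBDagger := by
  obtain ⟨l, hl, hl'⟩ := exists_symbol_BΛ
  obtain ⟨t, ht, ht'⟩ := exists_symbol_Bt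
  obtain ⟨b, hb, hb'⟩ := exists_symbol_Bβ
  have key : ∀ {m : ScalarSymbol}, (m = l ∨ m = t ∨ m = b) →
      translationConj s (multOp volume (multiplierHom m)) ∈ algBDagger := by
    intro m hm
    rw [translationConj_multOp, translateSymbol_multiplierHom, ← mem_daggerSymbols]
    refine translate_mem_of_mem daggerSymbols isClosed_daggerSymbols hs hl' ht' hb' ?_ ?_ ?_ hm
    · rw [mem_daggerSymbols, ← hl]; exact multOp_BΛ_mem
    · rw [mem_daggerSymbols, ← ht]; exact multOp_Bt_mem
    · rw [mem_daggerSymbols, ← hb]; exact multOp_Bβ_mem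
  refine algBDagger_le (S := algBDagger.comap (translationConj s : BoundedOps →⋆ₐ[ℂ] BoundedOps))
    (isClosed_algBDagger.preimage (StarAlgEquiv.isometry (translationConj s)).continuous)
    (fun a ha => ?_) ?_ ?_ ?_ hB
  · change translationConj s (opA a) ∈ algBDagger
    rw [opA, translationConj_multOp]
    exact opA_mem_algBDagger ha
  · rw [hl]; exact key (Or.inl rfl)
  · rw [ht]; exact key (Or.inr (Or.inl rfl))
  · rw [hb]; exact key (Or.inr (Or.inr rfl))

/-- The automorphism `[α(B)](τ) = B(τ - 1)` of `ℬ†`. -/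
noncomputable def shiftAut : algBDagger ≃⋆ₐ[ℂ] algBDagger where
  toFun B := ⟨translationConj 1 B, translationConj_mem (by simp) B.2⟩
  invFun B := ⟨translationConj (-1) B, translationConj_mem (by simp) B.2⟩
  left_inv B := Subtype.ext (translationConj_neg 1 B)
  right_inv B := Subtype.ext (by
    have h := translationConj_neg (-1) B
    rwa [neg_neg] at h)
  map_mul' A B := Subtype.ext (map_mul (translationConj 1) (A : BoundedOps) B)
  map_add' A B := Subtype.ext (map_add (translationConj 1) (A : BoundedOps) B)
  map_smul' c A := Subtype.ext (map_smul (translationConj 1) c (A : BoundedOps))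
  map_star' A := Subtype.ext (map_star (translationConj 1) (A : BoundedOps))

theorem coe_shiftAut (B : algBDagger) : (shiftAut B : BoundedOps) = translationConj 1 B := rfl

end Dagger

/-! ### The covariant representation with range dense in `ℬ◇` -/

section Diamond
open CrossedL1

instance nontrivial_L2Ω : Nontrivial L2Ω := by
  have hv : (fourierLp (T := 2 * Real.pi) 2 0 : L2S) ≠ 0 :=
    (orthonormal_fourier (T := 2 * Real.pi)).ne_zero 0
  have hfin : volume (Set.Icc (0 : ℝ) 1) ≠ ∞ := by simp
  refine ⟨indicatorConstLp 2 measurableSet_Icc hfin (fourierLp (T := 2 * Real.pi) 2 0 : L2S), 0,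
    fun h => hv ?_⟩
  have h2 := congrArg norm h
  rw [norm_indicatorConstLp (by simp) (by simp), norm_zero] at h2
  simpa using h2

/-- The translation by one, as a unitary operator on `L²(Ω)`. -/
noncomputable abbrev shiftΩ : unitary BoundedOps := shiftUnitary (E := L2S)

/-- The translation by one implements the automorphism `α` of `ℬ†`. -/
theorem shiftΩ_covariant (B : algBDagger) :
    algBDagger.subtype (shiftAut B) * (shiftΩ : BoundedOps) =
      (shiftΩ : BoundedOps) * algBDagger.subtype B :=
  ContinuousLinearMap.ext fun u => translationConj_apply 1 (B : BoundedOps) u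

/-- The representation of `ℓ¹(ℤ, ℬ†)` on `L²(Ω)` that is given by the inclusion of `ℬ†` and the
translation by one. -/
noncomputable def shiftRep : CrossedL1 shiftAut →⋆ₐ[ℂ] BoundedOps :=
  integrated algBDagger.subtype shiftΩ shiftΩ_covariant

theorem shiftRep_single (n : ℤ) (B : algBDagger) :
    shiftRep (single n B) = (B : BoundedOps) * ((shiftΩ ^ n : unitary BoundedOps) : BoundedOps) :=
  integrated_single _ _ shiftΩ_covariant n B

theorem shiftRep_coeff (B : algBDagger) : shiftRep (single 0 B) = (B : BoundedOps) := by
  rw [shiftRep_single, zpow_zero]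
  exact mul_one _

theorem circle_zpow_eq_exp (z : Circle) (n : ℤ) :
    ((z ^ n : Circle) : ℂ) = Complex.exp (((Complex.arg z * n : ℝ) : ℂ) * Complex.I) := by
  have h : ((z ^ n : Circle) : ℂ) = ((Circle.exp (Complex.arg z) ^ n : Circle) : ℂ) := by
    rw [Circle.exp_arg]
  rw [h, Circle.coe_zpow, Circle.coe_exp, ← Complex.exp_int_mul]
  congr 1
  push_cast
  ring

/-- Conjugation with the multiplication by `e^{iθτ}`, where `z = e^{iθ}`, implements the dual
action: it fixes the elements of `ℬ†`, which are multiplication operators. -/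
theorem gaugeConj_shiftRep (z : Circle) (n : ℤ) (B : algBDagger) :
    gaugeConj (E := L2S) (Complex.arg z) (shiftRep (single n B)) =
      ((z ^ n : Circle) : ℂ) • shiftRep (single n B) := by
  obtain ⟨f, hf⟩ := exists_multOp_of_mem B.2
  rw [shiftRep_single, hf, circle_zpow_eq_exp]
  exact gaugeConj_apply (E := L2S) (Complex.arg z) f n

/-- The powers of the translation are the conjugates of the multiplications by `e^{-int}`, so they
belong to `ℬ◇`. -/
theorem fourierConj_opP_expFun_int (n : ℤ) :
    fourierConj (opP (expFun (-n))) = ((shiftΩ ^ n : unitary BoundedOps) : BoundedOps) := by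
  refine ContinuousLinearMap.ext fun u => ?_
  rw [fourierConj_opP_expFun]
  exact (shiftUnitary_zpow (E := L2S) n u).symm

/-- Functions on the circle as `2π`-periodic functions on the line. -/
noncomputable def pullback : C(S1, ℂ) →⋆ₐ[ℂ] (ℝ →ᵇ ℂ) where
  toFun p := (BoundedContinuousFunction.mkOfCompact p).compContinuous
    ⟨fun t => (t : S1), AddCircle.continuous_mk' _⟩
  map_one' := rfl
  map_mul' _ _ := rfl
  map_zero' := rfl
  map_add' _ _ := rfl
  commutes' _ := rfl
  map_star' _ := rfl

theorem pullback_apply (p : C(S1, ℂ)) (t : ℝ) : pullback p t = p (t : S1) := rfl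

theorem exists_pullback_eq {p : ℝ →ᵇ ℂ} (hp : Function.Periodic p (2 * Real.pi)) :
    ∃ q : C(S1, ℂ), p = pullback q := by
  refine ⟨⟨hp.lift, ?_⟩, ?_⟩
  · exact continuous_coinduced_dom.2 p.continuous
  · ext t; rfl

theorem pullback_fourier (n : ℤ) : pullback (fourier n) = expFun n := by
  ext t
  rw [pullback_apply, fourier_coe_apply, expFun_apply]
  congr 1
  have : (Real.pi : ℂ) ≠ 0 := by exact_mod_cast Real.pi_ne_zero
  push_cast
  field_simp

theorem periodic_expFun (n : ℤ) : Function.Periodic (expFun n) (2 * Real.pi) := by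
  intro t
  rw [← pullback_fourier, pullback_apply, pullback_apply, AddCircle.coe_add_period]

theorem mem_algDiamond_of_mem {T : BoundedOps} (hT : T ∈ algDagger) : T ∈ algDiamond :=
  StarSubalgebra.le_topologicalClosure _ (StarAlgebra.subset_adjoin ℂ _ (Or.inl hT))

theorem opP_mem_algDiamond {p : ℝ →ᵇ ℂ} (hp : Function.Periodic p (2 * Real.pi)) :
    opP p ∈ algDiamond :=
  StarSubalgebra.le_topologicalClosure _ (StarAlgebra.subset_adjoin ℂ _ (Or.inr ⟨p, hp, rfl⟩))

theorem isClosed_algBDiamond : IsClosed (algBDiamond : Set BoundedOps) := by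
  have h : IsClosed (algDiamond : Set BoundedOps) := StarSubalgebra.isClosed_topologicalClosure _
  exact ((StarAlgEquiv.isometry fourierConj).isClosedEmbedding.isClosedMap) _ h

theorem shiftRep_single_mem (n : ℤ) (B : algBDagger) :
    shiftRep (single n B) ∈ algBDiamond := by
  rw [shiftRep_single]
  refine mul_mem ?_ ?_
  · obtain ⟨T, hT, hTB⟩ := B.2
    rw [← hTB]
    exact ⟨T, mem_algDiamond_of_mem hT, rfl⟩
  · rw [← fourierConj_opP_expFun_int]
    have h := periodic_expFun (-n)
    rw [Int.cast_neg] at h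
    exact ⟨_, opP_mem_algDiamond h, rfl⟩

/-- The multiplications by periodic functions, conjugated by the Fourier transform. -/
noncomputable def periodicOp : C(S1, ℂ) →⋆ₐ[ℂ] BoundedOps :=
  (fourierConj : BoundedOps →⋆ₐ[ℂ] BoundedOps).comp
    ((multOpHom (E := L2S) (volume : Measure ℝ)).comp (scalarFunHom.comp pullback))

theorem periodicOp_apply (p : C(S1, ℂ)) : periodicOp p = fourierConj (opP (pullback p)) := rfl

/-- Every conjugated multiplication by a periodic function is a limit of linear combinations of
powers of the translation, because trigonometric polynomials are uniformly dense. -/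
theorem periodicOp_mem_range (p : C(S1, ℂ)) :
    periodicOp p ∈ shiftRep.range.topologicalClosure := by
  let K : Submodule ℂ BoundedOps :=
    shiftRep.range.topologicalClosure.toSubalgebra.toSubmodule
  let L : C(S1, ℂ) →ₗ[ℂ] BoundedOps := periodicOp.toAlgHom.toLinearMap
  have hc : Continuous L := AddMonoidHomClass.continuous_of_bound L 1 fun q => by
    rw [one_mul]; exact NonUnitalStarAlgHom.norm_apply_le periodicOp q
  have hK : IsClosed (K : Set BoundedOps) := isClosed_closure
  have h : (⊤ : Submodule ℂ C(S1, ℂ)) ≤ K.comap L := by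
    rw [← span_fourier_closure_eq_top]
    refine Submodule.topologicalClosure_minimal _ (Submodule.span_le.2 ?_) (hK.preimage hc)
    rintro _ ⟨n, rfl⟩
    change periodicOp (fourier n) ∈ closure (shiftRep.range : Set BoundedOps)
    refine subset_closure ⟨single (-n) 1, ?_⟩
    refine (shiftRep_single (-n) 1).trans ?_
    have h := fourierConj_opP_expFun_int (-n)
    rw [Int.cast_neg, neg_neg] at h
    rw [periodicOp_apply, pullback_fourier, h]
    exact one_mul _
  exact h (Submodule.mem_top (x := p))

theorem closure_range_shiftRep :
    shiftRep.range.topologicalClosure = algBDiamond := by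
  refine le_antisymm (closure_minimal ?_ isClosed_algBDiamond) ?_
  · rintro _ ⟨x, rfl⟩
    have hc : Continuous shiftRep := AddMonoidHomClass.continuous_of_bound shiftRep 1
      fun x => by rw [one_mul]; exact CrossedRep.norm_le shiftRep x
    have hx := x.hasSum_single.map shiftRep hc
    exact isClosed_algBDiamond.mem_of_tendsto hx (Filter.Eventually.of_forall fun s =>
      sum_mem fun n _ => shiftRep_single_mem n (x n))
  · have h : algDiamond ≤ shiftRep.range.topologicalClosure.comap
        (fourierConj : BoundedOps →⋆ₐ[ℂ] BoundedOps) := by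
      refine StarSubalgebra.topologicalClosure_minimal (StarAlgebra.adjoin_le ?_)
        (isClosed_closure.preimage continuous_fourierConj)
      rintro T (hT | ⟨p, hp, rfl⟩)
      · exact subset_closure ⟨single 0 ⟨_, fourierConj_mem_algBDagger hT⟩, shiftRep_coeff _⟩
      · obtain ⟨q, rfl⟩ := exists_pullback_eq hp
        exact periodicOp_mem_range q
    rintro _ ⟨T, hT, rfl⟩
    exact h hT

end Diamond

theorem mainTheorem2 :
    ∃ α : algBDagger ≃⋆ₐ[ℂ] algBDagger,
      (∀ B : algBDagger, ∃ f : ℝ →ᵇ (L2S →L[ℂ] L2S),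
        (B : BoundedOps) = multOp MeasureTheory.volume f ∧
          (α B : BoundedOps) = multOp MeasureTheory.volume (translateOne f)) ∧
      Nonempty (CrossedProduct α ≃⋆ₐ[ℂ] algBDiamond) := by
  refine ⟨shiftAut, fun B => ?_, ?_⟩
  · obtain ⟨f, hf⟩ := exists_multOp_of_mem B.2
    refine ⟨f, hf, ?_⟩
    rw [coe_shiftAut, hf]
    exact translationConj_multOp 1 f
  · have hinj : Function.Injective fun B : algBDagger =>
        shiftRep (CrossedL1.single 0 B) := fun A B h => by
      have h' : (A : BoundedOps) = B :=
        (shiftRep_coeff A).symm.trans (Eq.trans h (shiftRep_coeff B))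
      exact Subtype.ext h'
    have h := nonempty_crossedProduct_equiv shiftRep hinj
      (fun z => gaugeConj (E := L2S) (Complex.arg z)) gaugeConj_shiftRep
    rw [← closure_range_shiftRep]
    exact h
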